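/- Let $M$ be a closed (compact, without boundary) connected oriented smooth Riemannian surface with volume form $dV$, let $\pi:P\to M$ be a smooth principal $U(1)$-bundle, and identify the Lie algebra $i\mathbb{R}$ of $U(1)$ with $\mathbb{R}$, so that a connection on $P$ is a smooth $U(1)$-invariant real-valued $1$-form $A$ on $P$ which takes the value $1$ on the vector field generating the action $t\mapsto e^{it}$. The curvature of $A$ is the unique $2$-form $F_A$ on $M$ with $\pi^\ast F_A=dA$ (such a form exists for every connection), $A$ is called Yang-Mills if $d^\star F_A=0$, where $d^\star=-\star d\star$ is the codifferential on $2$-forms of $M$, and the Chern number of $P$ is $$c=\frac{1}{2\pi}\int_M F_{A'},$$ where $A'$ is any connection on $P$. Then the Chern number does not depend on the choice of $A'$, and for every Yang-Mills connection $A$ on $P$ the curvature is a constant multiple of the volume form: $$F_A=\lambda\, dV,\qquad \lambda=\frac{2\pi c}{\mathrm{Vol}(M)},\qquad \mathrm{Vol}(M)=\int_M dV .$$ -/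

import Mathlib

open Set Filter MeasureTheory Bundle
open scoped Manifold ContDiff Topology Bundle

noncomputable section

namespace YMSurface

/-! ### Differential forms on manifolds without boundary -/

section Forms

variable {E : Type*} [NormedAddCommGroup E] [NormedSpace ℝ E]
  {H : Type*} [TopologicalSpace H] (I : ModelWithCorners ℝ E H)
  (N : Type*) [TopologicalSpace N] [ChartedSpace H N]

/-- A (not necessarily smooth) real-valued differential `k`-form on the manifold `N`. -/
abbrev DForm (k : ℕ) : Type _ := ∀ p : N, TangentSpace I p [⋀^Fin k]→L[ℝ] ℝ

variable {I N}

/-- The coordinate expression of a `k`-form in the preferred chart at `p₀`: its pullback to the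
model vector space under the inverse of the chart. -/
def DForm.inChart {k : ℕ} (η : DForm I N k) (p₀ : N) (u : E) : E [⋀^Fin k]→L[ℝ] ℝ :=
  (η ((extChartAt I p₀).symm u)).compContinuousLinearMap
    (mfderiv 𝓘(ℝ, E) I (extChartAt I p₀).symm u)

/-- A `k`-form is smooth if its coordinate expressions are smooth. -/
def DForm.IsSmooth {k : ℕ} (η : DForm I N k) : Prop :=
  ∀ p₀ : N, ContDiffOn ℝ ∞ (η.inChart p₀) (extChartAt I p₀).target

/-- The exterior derivative of a `k`-form on a manifold without boundary: at `p` it is computed in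
the chart at `p`. -/
def DForm.d {k : ℕ} (η : DForm I N k) : DForm I N (k + 1) := fun p =>
  (extDeriv (η.inChart p) (extChartAt I p p)).compContinuousLinearMap
    (mfderiv I 𝓘(ℝ, E) (extChartAt I p) p)

end Forms

/-! ### Oriented Riemannian surfaces -/

section Surface

variable {M : Type*} [TopologicalSpace M] [ChartedSpace (EuclideanSpace ℝ (Fin 2)) M]

instance tangentSpace_finrank (x : M) :
    Fact (Module.finrank ℝ (TangentSpace (𝓡 2) x) = 2) :=
  ⟨finrank_euclideanSpace_fin (𝕜 := ℝ) (n := 2)⟩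

/-- The frame `(∂₁, ∂₂)` of the coordinates given by the preferred chart at `x₀`, at the point with
coordinates `u`. -/
def coordFrame (x₀ : M) (u : EuclideanSpace ℝ (Fin 2)) :
    Fin 2 → TangentSpace (𝓡 2) ((extChartAt (𝓡 2) x₀).symm u) := fun i =>
  mfderiv 𝓘(ℝ, EuclideanSpace ℝ (Fin 2)) (𝓡 2) (extChartAt (𝓡 2) x₀).symm u
    (EuclideanSpace.single i (1 : ℝ))

/-- `+1` on positively oriented frames, `-1` on negatively oriented ones, `0` on linearly dependent
pairs of vectors. -/
def frameSign {V : Type*} [AddCommGroup V] [Module ℝ V] (o : Orientation ℝ V (Fin 2))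
    (v : Fin 2 → V) : SignType :=
  SignType.sign (o.someVector v)

variable (M) in
/-- An orientation of the surface `M`: an orientation of every tangent plane, such that the sign of
the coordinate frame of every chart of the preferred family is locally constant. -/
structure SurfaceOrientation where
  orient : ∀ x : M, Orientation ℝ (TangentSpace (𝓡 2) x) (Fin 2)
  continuousOn_sign : ∀ x₀ : M, ContinuousOn
    (fun u => frameSign (orient ((extChartAt (𝓡 2) x₀).symm u)) (coordFrame x₀ u))
    (extChartAt (𝓡 2) x₀).target

/-- The chosen smooth partition of unity subordinate to the family of the domains of the preferred
charts, used to define integrals. -/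
def chartPartition (M : Type*) [TopologicalSpace M] [ChartedSpace (EuclideanSpace ℝ (Fin 2)) M]
    [IsManifold (𝓡 2) ∞ M] [T2Space M] [SigmaCompactSpace M] :
    SmoothPartitionOfUnity M (𝓡 2) M univ :=
  (SmoothPartitionOfUnity.exists_isSubordinate_chartAt_source (𝓡 2) M).choose

/-- The integral of a `2`-form over a compact oriented surface: with a partition of unity `ρ`
subordinate to the charts, `∑ ∫ ± ρ η(∂₁, ∂₂) du¹ du²`, where the sign is that of the coordinate
frame. -/
def formIntegral [IsManifold (𝓡 2) ∞ M] [T2Space M] [SigmaCompactSpace M]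
    (o : SurfaceOrientation M) (η : DForm (𝓡 2) M 2) : ℝ :=
  ∑ᶠ x₀ : M, ∫ u in (extChartAt (𝓡 2) x₀).target,
    chartPartition M x₀ ((extChartAt (𝓡 2) x₀).symm u) *
      ((frameSign (o.orient ((extChartAt (𝓡 2) x₀).symm u)) (coordFrame x₀ u) : SignType) : ℝ) *
      η ((extChartAt (𝓡 2) x₀).symm u) (coordFrame x₀ u)

variable [RiemannianBundle (fun x : M => TangentSpace (𝓡 2) x)]

/-- The Riemannian volume form `dV` of an oriented Riemannian surface. -/
def volForm (o : SurfaceOrientation M) : DForm (𝓡 2) M 2 := fun x =>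
  (o.orient x).volumeForm.mkContinuous 1
    (fun v => by simpa using (o.orient x).abs_volumeForm_apply_le v)

/-- The volume `∫ dV` of a closed oriented Riemannian surface. -/
def surfaceVolume [IsManifold (𝓡 2) ∞ M] [T2Space M] [SigmaCompactSpace M]
    (o : SurfaceOrientation M) : ℝ :=
  formIntegral o (volForm o)

/-- The Hodge star of a `2`-form: its value on a positively oriented orthonormal basis. -/
def hodgeStarTwo (o : SurfaceOrientation M) (η : DForm (𝓡 2) M 2) : M → ℝ := fun x =>
  η x ((o.orient x).finOrthonormalBasis two_pos Fact.out)

/-- The Hodge star of a `1`-form: `⋆α = - α ∘ J`, where `J` is the rotation by a positive right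
angle, so that `⋆e¹ = e²` and `⋆e² = -e¹` for a positively oriented orthonormal coframe. -/
def hodgeStarOne (o : SurfaceOrientation M) (α : ∀ x : M, TangentSpace (𝓡 2) x →L[ℝ] ℝ) :
    ∀ x : M, TangentSpace (𝓡 2) x →L[ℝ] ℝ := fun x =>
  -((α x).comp (o.orient x).rightAngleRotation.toContinuousLinearEquiv.toContinuousLinearMap)

/-- The codifferential `d⋆ = -⋆d⋆` on `2`-forms of an oriented Riemannian surface. -/
def codifferential (o : SurfaceOrientation M) (η : DForm (𝓡 2) M 2) :
    ∀ x : M, TangentSpace (𝓡 2) x →L[ℝ] ℝ := fun x =>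
  -(hodgeStarOne o (fun y => mfderiv (𝓡 2) 𝓘(ℝ, ℝ) (hodgeStarTwo o η) y) x)

end Surface

/-! ### Principal circle bundles and connections -/

section Bundle

variable {M : Type*} [TopologicalSpace M] [ChartedSpace (EuclideanSpace ℝ (Fin 2)) M]
  {EP : Type*} [NormedAddCommGroup EP] [NormedSpace ℝ EP]
  {HP : Type*} [TopologicalSpace HP] (IP : ModelWithCorners ℝ EP HP)
  {P : Type*} [TopologicalSpace P] [ChartedSpace HP P] [MulAction Circle P]

/-- `pr : P → M` is a smooth principal `U(1)`-bundle: every point of the base has a neighbourhood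
over which `P` is equivariantly diffeomorphic to the product with `U(1)`, over the base. -/
def IsPrincipalCircleBundle (pr : P → M) : Prop :=
  ∀ x : M, ∃ e : Trivialization Circle pr, x ∈ e.baseSet ∧
    ContMDiffOn IP ((𝓡 2).prod (𝓡 1)) ∞ e e.source ∧
    ContMDiffOn ((𝓡 2).prod (𝓡 1)) IP ∞ e.toOpenPartialHomeomorph.symm e.target ∧
    ∀ (z : Circle) (p : P), p ∈ e.source → z • p ∈ e.source ∧ e (z • p) = ((e p).1, z * (e p).2)

variable (P) in
/-- A connection on a principal `U(1)`-bundle with total space `P`, given by its connection `1`-form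
under the identification of the Lie algebra `iℝ` of `U(1)` with `ℝ`. -/
structure CircleConnection where
  form : DForm IP P 1
  smooth : DForm.IsSmooth form
  /-- The form takes the value `1` on the generator of the action `t ↦ exp(it) • p`. -/
  vertical : ∀ p : P, form (Circle.exp 0 • p)
    (fun _ => mfderiv 𝓘(ℝ, ℝ) IP (fun t : ℝ => Circle.exp t • p) 0 (1 : ℝ)) = 1
  /-- The form is invariant under the action. -/
  invariant : ∀ (z : Circle) (p : P),
    (form (z • p)).compContinuousLinearMap (mfderiv IP IP (fun q : P => z • q) p) = form p

variable {IP}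

/-- `F` is the curvature of `A`: the pullback of the `2`-form `F` on the base is `dA` (which is the
covariant exterior derivative of `A`, as `U(1)` is abelian). -/
def CircleConnection.IsCurvature (pr : P → M) (A : CircleConnection IP P) (F : DForm (𝓡 2) M 2) :
    Prop :=
  ∀ p : P, DForm.d A.form p = (F (pr p)).compContinuousLinearMap (mfderiv IP (𝓡 2) pr p)

open Classical in
/-- The curvature of a connection on a principal `U(1)`-bundle, as a `2`-form on the base: the
unique `2`-form that satisfies `IsCurvature` (it exists for every connection on such a bundle). -/
def CircleConnection.curvature (pr : P → M) (A : CircleConnection IP P) : DForm (𝓡 2) M 2 :=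
  if h : ∃ F : DForm (𝓡 2) M 2, A.IsCurvature pr F then h.choose else 0

/-- The Chern number `(1 / 2pr) ∫ F` computed with the connection `A`. -/
def CircleConnection.chernNumber [IsManifold (𝓡 2) ∞ M] [T2Space M] [SigmaCompactSpace M]
    (pr : P → M) (o : SurfaceOrientation M) (A : CircleConnection IP P) : ℝ :=
  1 / (2 * Real.pi) * formIntegral o (A.curvature pr)

/-- `A` is a Yang-Mills connection: `d⋆F = 0`. -/
def CircleConnection.IsYangMills [RiemannianBundle (fun x : M => TangentSpace (𝓡 2) x)]
    (pr : P → M) (o : SurfaceOrientation M) (A : CircleConnection IP P) : Prop :=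
  ∀ x : M, codifferential o (A.curvature pr) x = 0

end Bundle

end YMSurface

end

/-! Put f = ⋆F_A. On 1-forms ⋆ is, up to sign, composition with a rotation, hence injective, so
d⋆F_A = 0 says df = 0 (`mfderiv_hodgeStarTwo_eq_zero`) and f is a constant λ on the connected
surface (`hodgeStarTwo_const`). Every 2-form on M is its star times dV (`eq_hodgeStarTwo_smul`), so
F_A = λ dV. Integrating gives 2πc = λ Vol(M), and Vol(M) > 0 (`surfaceVolume_pos`) determines λ.

The facts about the bundle rest on one local formula, `IsSmoothEquivariant.form_eq`: in a
trivialization with unit section s and fibre angle θ, A = π^*(s^*A) + dθ. Hence dA = π^*d(s^*A), so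
the curvature exists, equals d(s^*A) locally, and is smooth. For two connections the terms dθ
cancel, so A' - A descends to a 1-form α on M with F_{A'} = F_A + dα (`exists_curvature_eq_add`).
Stokes' theorem on the closed surface (`formIntegral_d_eq_zero`) then makes the Chern number
independent of the connection.

Since d and the integral are defined through preferred charts and dV pointwise, three facts have to
be supplied: d commutes with pullbacks (`DForm.d_pullback`), the integral of a form supported in two
charts is the same in both (`chartIntegral_eq`), and dV is smooth (`contDiffAt_volForm`). -/

noncomputable section

namespace YMSurface

/-! ### Pullbacks, smoothness and the exterior derivative in charts -/

section Naturality

variable {E : Type*} [NormedAddCommGroup E] [NormedSpace ℝ E]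
  {H : Type*} [TopologicalSpace H] {I : ModelWithCorners ℝ E H}
  {N : Type*} [TopologicalSpace N] [ChartedSpace H N]
  {E' : Type*} [NormedAddCommGroup E'] [NormedSpace ℝ E']
  {H' : Type*} [TopologicalSpace H'] {I' : ModelWithCorners ℝ E' H'}
  {N' : Type*} [TopologicalSpace N'] [ChartedSpace H' N']

/-- The pullback of a differential form by a map. -/
def DForm.pullback {k : ℕ} (I : ModelWithCorners ℝ E H) (f : N → N') (η : DForm I' N' k) :
    DForm I N k := fun p => (η (f p)).compContinuousLinearMap (mfderiv I I' f p)

/-- A form is smooth at a point if its expression in the preferred chart there is. -/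
def DForm.SmoothAt {k : ℕ} (η : DForm I N k) (p : N) : Prop :=
  ContDiffAt ℝ ∞ (η.inChart p) (extChartAt I p p)

/-- Every tangent space is definitionally `E`, so values at propositionally equal base points can be
compared on the same vectors, without casts between fibres. -/
theorem DForm.apply_eq_of_eq {k : ℕ} (η : DForm I N k) {x y : N} (h : x = y) (v : Fin k → E) :
    η x v = η y v := by
  subst h; rfl

theorem minSmoothness_two_le : minSmoothness ℝ 2 ≤ ∞ := by
  rw [minSmoothness_of_isRCLikeNormedField]
  exact WithTop.coe_le_coe.2 le_top

theorem mdifferentiableAt_extChartAt_symm [I.Boundaryless] [IsManifold I ∞ N] {p : N} {u : E}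
    (hu : u ∈ (extChartAt I p).target) :
    MDifferentiableAt 𝓘(ℝ, E) I (extChartAt I p).symm u :=
  ((contMDiffOn_extChartAt_symm (n := ∞) p).contMDiffAt
    ((isOpen_extChartAt_target p).mem_nhds hu)).mdifferentiableAt (by simp)

theorem mdifferentiableAt_extChartAt' [IsManifold I ∞ N] {p x : N}
    (hx : x ∈ (extChartAt I p).source) :
    MDifferentiableAt I 𝓘(ℝ, E) (extChartAt I p) x :=
  (contMDiffAt_extChartAt' (n := ∞) (by simpa using hx)).mdifferentiableAt (by simp)

/-- The coordinate expression of a map. -/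
def coordMap (I : ModelWithCorners ℝ E H) (I' : ModelWithCorners ℝ E' H') (f : N → N')
    (p : N) (q : N') : E → E' :=
  extChartAt I' q ∘ f ∘ (extChartAt I p).symm

theorem contDiffAt_coordMap [I.Boundaryless] [IsManifold I ∞ N] [IsManifold I' ∞ N']
    {f : N → N'} {p : N} {q : N'} {u : E} (hu : u ∈ (extChartAt I p).target)
    (hf : ContMDiffAt I I' ∞ f ((extChartAt I p).symm u))
    (hq : f ((extChartAt I p).symm u) ∈ (extChartAt I' q).source) :
    ContDiffAt ℝ ∞ (coordMap I I' f p q) u := by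
  rw [← contMDiffAt_iff_contDiffAt]
  have h1 : ContMDiffAt 𝓘(ℝ, E) I ∞ (extChartAt I p).symm u :=
    (contMDiffOn_extChartAt_symm (n := ∞) p).contMDiffAt
      ((isOpen_extChartAt_target p).mem_nhds hu)
  have h2 : ContMDiffAt I' 𝓘(ℝ, E') ∞ (extChartAt I' q) (f ((extChartAt I p).symm u)) :=
    contMDiffAt_extChartAt' (n := ∞) (by simpa using hq)
  exact h2.comp u (hf.comp u h1)

theorem fderiv_coordMap [I.Boundaryless] [IsManifold I ∞ N] [IsManifold I' ∞ N']
    {f : N → N'} {p : N} {q : N'} {u : E} (hu : u ∈ (extChartAt I p).target)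
    (hf : MDifferentiableAt I I' f ((extChartAt I p).symm u))
    (hq : f ((extChartAt I p).symm u) ∈ (extChartAt I' q).source) (v : E) :
    fderiv ℝ (coordMap I I' f p q) u v =
      mfderiv I' 𝓘(ℝ, E') (extChartAt I' q) (f ((extChartAt I p).symm u))
        (mfderiv I I' f ((extChartAt I p).symm u)
          (mfderiv 𝓘(ℝ, E) I (extChartAt I p).symm u v)) := by
  rw [← mfderiv_eq_fderiv]
  have h1 := mdifferentiableAt_extChartAt_symm hu
  have h3 : mfderiv 𝓘(ℝ, E) 𝓘(ℝ, E') (coordMap I I' f p q) u = _ :=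
    mfderiv_comp u (mdifferentiableAt_extChartAt' hq) (hf.comp u h1)
  rw [h3, mfderiv_comp u hf h1]
  rfl

theorem mfderiv_symm_extChartAt [I.Boundaryless] [IsManifold I ∞ N] {p x : N}
    (hx : x ∈ (extChartAt I p).source) (v : E) :
    (mfderiv 𝓘(ℝ, E) I (extChartAt I p).symm (extChartAt I p x)
      (mfderiv I 𝓘(ℝ, E) (extChartAt I p) x v) : E) = v := by
  have h1 := mdifferentiableAt_extChartAt_symm ((extChartAt I p).map_source hx)
  have h2 := mfderiv_comp x h1 (mdifferentiableAt_extChartAt' hx)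
  have h3 : (extChartAt I p).symm ∘ extChartAt I p =ᶠ[𝓝 x] id := by
    filter_upwards [(isOpen_extChartAt_source p).mem_nhds hx] with y hy
    exact (extChartAt I p).left_inv hy
  rw [h3.mfderiv_eq] at h2
  have h4 := congrArg (fun L : E →L[ℝ] E => L v) h2
  exact h4.symm.trans (by rw [mfderiv_id]; rfl)

/-- The charts at `p` and `q` need only contain the point and its image. Taking `f = id` therefore
yields the change-of-chart formula. -/
theorem DForm.inChart_pullback [I.Boundaryless] [I'.Boundaryless] [IsManifold I ∞ N]
    [IsManifold I' ∞ N'] {k : ℕ} (η : DForm I' N' k) {f : N → N'} {p : N} {q : N'} {u : E}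
    (hu : u ∈ (extChartAt I p).target)
    (hf : MDifferentiableAt I I' f ((extChartAt I p).symm u))
    (hq : f ((extChartAt I p).symm u) ∈ (extChartAt I' q).source) :
    (η.pullback I f).inChart p u = (η.inChart q (coordMap I I' f p q u)).compContinuousLinearMap
      (fderiv ℝ (coordMap I I' f p q) u) := by
  ext v
  have e : (extChartAt I' q).symm (coordMap I I' f p q u) = f ((extChartAt I p).symm u) :=
    (extChartAt I' q).left_inv hq
  refine Eq.trans ?_ (η.apply_eq_of_eq e.symm _)
  change η _ (fun i => _) = η _ (fun i => _)
  congr 1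
  funext i
  change _ = mfderiv 𝓘(ℝ, E') I' (extChartAt I' q).symm (coordMap I I' f p q u)
    (fderiv ℝ (coordMap I I' f p q) u (v i))
  rw [fderiv_coordMap hu hf hq]
  exact (mfderiv_symm_extChartAt hq _).symm

theorem DForm.inChart_eventuallyEq [I.Boundaryless] [I'.Boundaryless] [IsManifold I ∞ N]
    [IsManifold I' ∞ N'] {k : ℕ} (η : DForm I' N' k) {f : N → N'} {p : N} {q : N'} {u : E}
    (hu : u ∈ (extChartAt I p).target)
    (hf : ContMDiffAt I I' ∞ f ((extChartAt I p).symm u))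
    (hq : f ((extChartAt I p).symm u) ∈ (extChartAt I' q).source) :
    (η.pullback I f).inChart p =ᶠ[𝓝 u]
      fun u => (η.inChart q (coordMap I I' f p q u)).compContinuousLinearMap
        (fderiv ℝ (coordMap I I' f p q) u) := by
  have hc : ContinuousAt (extChartAt I p).symm u :=
    (mdifferentiableAt_extChartAt_symm hu).continuousAt
  have h1 : ∀ᶠ x in 𝓝 ((extChartAt I p).symm u), MDifferentiableAt I I' f x := by
    have h0 : ContMDiffAt I I' 1 f ((extChartAt I p).symm u) := hf.of_le (by simp)
    have : IsManifold I 1 N := .of_le (n := ∞) (by simp)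
    have : IsManifold I' 1 N' := .of_le (n := ∞) (by simp)
    filter_upwards [(contMDiffAt_iff_contMDiffAt_nhds (by simp)).1 h0] with x hx
    exact hx.mdifferentiableAt (by simp)
  have h2 : ∀ᶠ x in 𝓝 ((extChartAt I p).symm u), f x ∈ (extChartAt I' q).source :=
    hf.continuousAt.eventually ((isOpen_extChartAt_source q).mem_nhds hq)
  filter_upwards [(isOpen_extChartAt_target p).mem_nhds hu, hc.eventually h1, hc.eventually h2]
    with w hw hw1 hw2
  exact η.inChart_pullback hw hw1 hw2

theorem DForm.pullback_id {k : ℕ} (η : DForm I N k) : η.pullback I id = η := by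
  funext p
  ext v
  change η p (fun i => mfderiv I I id p (v i)) = _
  simp only [mfderiv_id]
  rfl

/-- In degree one, alternating maps are linear functionals, and the operation becomes composition of
continuous linear maps. -/
theorem contDiffAt_compContinuousLinearMap_one {F : Type*} [NormedAddCommGroup F]
    [NormedSpace ℝ F] {β : F → E' [⋀^Fin 1]→L[ℝ] ℝ} {g : F → E →L[ℝ] E'} {u : F}
    (hω : ContDiffAt ℝ ∞ β u) (hg : ContDiffAt ℝ ∞ g u) :
    ContDiffAt ℝ ∞ (fun w => (β w).compContinuousLinearMap (g w)) u := by
  let L := (ContinuousAlternatingMap.ofSubsingletonLIE (𝕜 := ℝ) (E := E) (F := ℝ) (0 : Fin 1))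
  let L' := (ContinuousAlternatingMap.ofSubsingletonLIE (𝕜 := ℝ) (E := E') (F := ℝ) (0 : Fin 1))
  have h : (fun w => (β w).compContinuousLinearMap (g w)) =
      fun w => L ((L'.symm (β w)).comp (g w)) := by
    funext w
    obtain ⟨a, ha⟩ := L'.surjective (β w)
    rw [← ha, L'.symm_apply_apply]
    ext v
    rfl
  rw [h]
  exact L.contDiff.contDiffAt.comp u
    ((L'.symm.contDiff.contDiffAt.comp u hω).clm_comp hg)

theorem DForm.contDiffAt_inChart_pullback [I.Boundaryless] [I'.Boundaryless] [IsManifold I ∞ N]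
    [IsManifold I' ∞ N'] {η : DForm I' N' 1} {f : N → N'} {p : N} {q : N'} {u : E}
    (hu : u ∈ (extChartAt I p).target)
    (hf : ContMDiffAt I I' ∞ f ((extChartAt I p).symm u))
    (hq : f ((extChartAt I p).symm u) ∈ (extChartAt I' q).source)
    (hη : ContDiffAt ℝ ∞ (η.inChart q) (extChartAt I' q (f ((extChartAt I p).symm u)))) :
    ContDiffAt ℝ ∞ ((η.pullback I f).inChart p) u := by
  have hg := contDiffAt_coordMap hu hf hq
  have h1 : ContDiffAt ℝ ∞ (fun w => η.inChart q (coordMap I I' f p q w)) u :=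
    ContDiffAt.comp (g := η.inChart q) u hη hg
  exact (contDiffAt_compContinuousLinearMap_one h1
    (hg.fderiv_right (m := ∞) (by simp))).congr_of_eventuallyEq
      (η.inChart_eventuallyEq hu hf hq)

/-- `SmoothAt` looks only at the preferred chart of the point; pulling back by the identity
transfers it to any chart around the point. -/
theorem DForm.SmoothAt.contDiffAt_inChart [I.Boundaryless] [IsManifold I ∞ N] {η : DForm I N 1}
    {p : N} {u : E} (hu : u ∈ (extChartAt I p).target)
    (h : η.SmoothAt ((extChartAt I p).symm u)) : ContDiffAt ℝ ∞ (η.inChart p) u := by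
  have := DForm.contDiffAt_inChart_pullback (f := id) hu contMDiffAt_id
    (mem_extChartAt_source ((extChartAt I p).symm u)) h
  rwa [DForm.pullback_id] at this

theorem DForm.SmoothAt.pullback [I.Boundaryless] [I'.Boundaryless] [IsManifold I ∞ N]
    [IsManifold I' ∞ N'] {η : DForm I' N' 1} {f : N → N'} {p : N}
    (hη : η.SmoothAt (f p)) (hf : ContMDiffAt I I' ∞ f p) : (η.pullback I f).SmoothAt p := by
  have e : (extChartAt I p).symm (extChartAt I p p) = p := extChartAt_to_inv p
  apply DForm.contDiffAt_inChart_pullback (q := f p) (mem_extChartAt_target p)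
  · rwa [e]
  · rw [e]; exact mem_extChartAt_source _
  · rwa [e]

theorem DForm.IsSmooth.smoothAt [I.Boundaryless] {k : ℕ} {η : DForm I N k} (h : η.IsSmooth)
    (p : N) : η.SmoothAt p :=
  (h p).contDiffAt ((isOpen_extChartAt_target p).mem_nhds (mem_extChartAt_target p))

/-- The exterior derivative commutes with pullbacks. -/
theorem DForm.d_pullback [I.Boundaryless] [I'.Boundaryless] [IsManifold I ∞ N]
    [IsManifold I' ∞ N'] {k : ℕ} {η : DForm I' N' k} {f : N → N'} {p : N}
    (hη : η.SmoothAt (f p)) (hf : ContMDiffAt I I' ∞ f p) :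
    (η.pullback I f).d p = η.d.pullback I f p := by
  have e : (extChartAt I p).symm (extChartAt I p p) = p := extChartAt_to_inv p
  have hu := mem_extChartAt_target (I := I) p
  have hf' : ContMDiffAt I I' ∞ f ((extChartAt I p).symm (extChartAt I p p)) := by rwa [e]
  have hq : f ((extChartAt I p).symm (extChartAt I p p)) ∈ (extChartAt I' (f p)).source := by
    rw [e]; exact mem_extChartAt_source _
  have h1 := (η.inChart_eventuallyEq hu hf' hq).extDeriv_eq
  have e2 : coordMap I I' f p (f p) (extChartAt I p p) = extChartAt I' (f p) (f p) := by
    simp [coordMap]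
  have hη' : DifferentiableAt ℝ (η.inChart (f p))
      (coordMap I I' f p (f p) (extChartAt I p p)) := by
    rw [e2]; exact ContDiffAt.differentiableAt hη (by simp)
  rw [extDeriv_pullback hη' (contDiffAt_coordMap hu hf' hq) minSmoothness_two_le, e2] at h1
  unfold DForm.d DForm.pullback
  unfold DForm.pullback at h1
  rw [h1]
  ext v
  change extDeriv (η.inChart (f p)) _ (fun i => _) = extDeriv (η.inChart (f p)) _ (fun i => _)
  congr 1
  funext i
  have h3 := fderiv_coordMap hu (hf'.mdifferentiableAt (by simp)) hq
    (mfderiv I 𝓘(ℝ, E) (extChartAt I p) p (v i))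
  refine h3.trans ?_
  have h4 := mfderiv_symm_extChartAt (mem_extChartAt_source (I := I) p) (v i)
  -- The base point produced by the chart and its inverse is only propositionally `p`, so it is
  -- generalised before substitution.
  have h5 : ∀ (x : N) (hx : x = p) (w : E), w = v i →
    (mfderiv I' 𝓘(ℝ, E') (extChartAt I' (f p)) (f x) (mfderiv I I' f x w) : E') =
      mfderiv I' 𝓘(ℝ, E') (extChartAt I' (f p)) (f p) (mfderiv I I' f p (v i)) := by
    rintro x rfl w rfl; rfl
  exact h5 _ e _ h4

/-- `DForm.d` uses a different chart at each point. Naturality under the transition map shows that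
one fixed chart computes it on its whole target. -/
theorem DForm.inChart_d [I.Boundaryless] [IsManifold I ∞ N] {k : ℕ} {η : DForm I N k} {p : N}
    {u : E} (hu : u ∈ (extChartAt I p).target) (h : η.SmoothAt ((extChartAt I p).symm u)) :
    η.d.inChart p u = extDeriv (η.inChart p) u := by
  set x := (extChartAt I p).symm u with hx
  have hq : x ∈ (extChartAt I x).source := mem_extChartAt_source x
  have h1 := (η.inChart_eventuallyEq (f := id) hu contMDiffAt_id hq).extDeriv_eq
  rw [DForm.pullback_id] at h1
  have e2 : coordMap I I id p x u = extChartAt I x x := rfl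
  have hd : DifferentiableAt ℝ (η.inChart x) (coordMap I I id p x u) :=
    ContDiffAt.differentiableAt (n := ∞) h (by simp)
  rw [h1, extDeriv_pullback hd
    (contDiffAt_coordMap hu contMDiffAt_id hq) minSmoothness_two_le, e2]
  ext v
  change extDeriv (η.inChart x) _ (fun i => _) = extDeriv (η.inChart x) _ (fun i => _)
  congr 1
  funext i
  refine Eq.trans ?_ (fderiv_coordMap hu mdifferentiableAt_id hq (v i)).symm
  rw [mfderiv_id]
  rfl

theorem contDiffAt_extDeriv {k : ℕ} {β : E → E [⋀^Fin k]→L[ℝ] ℝ} {u : E}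
    (h : ContDiffAt ℝ ∞ β u) : ContDiffAt ℝ ∞ (extDeriv β) u := by
  have e : extDeriv β = fun w =>
      ContinuousAlternatingMap.alternatizeUncurryFinCLM (n := k) ℝ E ℝ (fderiv ℝ β w) := by
    funext w
    rw [ContinuousAlternatingMap.alternatizeUncurryFinCLM_apply, extDeriv]
  rw [e]
  exact (ContinuousAlternatingMap.alternatizeUncurryFinCLM
    (n := k) ℝ E ℝ).contDiff.contDiffAt.comp u (h.fderiv_right (m := ∞) (by simp))

theorem DForm.inChart_congr [I.Boundaryless] [IsManifold I ∞ N] {k : ℕ} {η η' : DForm I N k}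
    {p : N} {u : E} (hu : u ∈ (extChartAt I p).target)
    (h : ∀ᶠ x in 𝓝 ((extChartAt I p).symm u), η x = η' x) :
    η.inChart p =ᶠ[𝓝 u] η'.inChart p := by
  filter_upwards [(mdifferentiableAt_extChartAt_symm hu).continuousAt.eventually h] with w hw
  simp only [DForm.inChart, hw]

theorem DForm.SmoothAt.congr [I.Boundaryless] [IsManifold I ∞ N] {k : ℕ} {η η' : DForm I N k}
    {p : N} (hη : η.SmoothAt p) (h : ∀ᶠ x in 𝓝 p, η' x = η x) : η'.SmoothAt p :=
  ContDiffAt.congr_of_eventuallyEq hη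
    (DForm.inChart_congr (mem_extChartAt_target p) (by rwa [extChartAt_to_inv]))

theorem DForm.d_congr [I.Boundaryless] [IsManifold I ∞ N] {k : ℕ} {η η' : DForm I N k}
    {p : N} (h : ∀ᶠ x in 𝓝 p, η x = η' x) : η.d p = η'.d p := by
  unfold DForm.d
  rw [(DForm.inChart_congr (mem_extChartAt_target p)
    (by rwa [extChartAt_to_inv])).extDeriv_eq]

theorem DForm.contDiffAt_inChart_d [I.Boundaryless] [IsManifold I ∞ N] {η : DForm I N 1} {p : N}
    {u : E} (hu : u ∈ (extChartAt I p).target)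
    (h : ∀ᶠ x in 𝓝 ((extChartAt I p).symm u), η.SmoothAt x) :
    ContDiffAt ℝ ∞ (η.d.inChart p) u := by
  refine (contDiffAt_extDeriv (h.self_of_nhds.contDiffAt_inChart hu)).congr_of_eventuallyEq ?_
  filter_upwards [(mdifferentiableAt_extChartAt_symm hu).continuousAt.eventually h,
    (isOpen_extChartAt_target p).mem_nhds hu] with w hw hwt
  exact DForm.inChart_d hwt hw

theorem DForm.d_add {k : ℕ} {η η' : DForm I N k} {p : N} (h : η.SmoothAt p)
    (h' : η'.SmoothAt p) : DForm.d (I := I) (fun x => η x + η' x) p = η.d p + η'.d p := by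
  unfold DForm.d
  have e : DForm.inChart (I := I) (fun x => η x + η' x) p = η.inChart p + η'.inChart p := by
    funext u; rfl
  rw [e, extDeriv_add (ContDiffAt.differentiableAt h (by simp))
    (ContDiffAt.differentiableAt h' (by simp))]
  rfl

theorem DForm.d_neg {k : ℕ} {η : DForm I N k} {p : N} :
    DForm.d (I := I) (fun x => -η x) p = -η.d p := by
  unfold DForm.d
  have e : DForm.inChart (I := I) (fun x => -η x) p = (-1 : ℝ) • η.inChart p := by
    funext u
    ext v
    simp only [DForm.inChart, Pi.smul_apply]
    exact (neg_one_mul _).symm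
  rw [e, extDeriv_smul]
  ext v
  exact neg_one_mul _

theorem DForm.SmoothAt.add {k : ℕ} {η η' : DForm I N k} {p : N} (h : η.SmoothAt p)
    (h' : η'.SmoothAt p) : DForm.SmoothAt (I := I) (fun x => η x + η' x) p :=
  ContDiffAt.add h h'

theorem DForm.SmoothAt.neg {k : ℕ} {η : DForm I N k} {p : N} (h : η.SmoothAt p) :
    DForm.SmoothAt (I := I) (fun x => -η x) p :=
  ContDiffAt.neg h

theorem DForm.SmoothAt.smul [I.Boundaryless] [IsManifold I ∞ N] {k : ℕ} {η : DForm I N k} {p : N}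
    (h : η.SmoothAt p) {ρ : N → ℝ} (hρ : ContMDiffAt I 𝓘(ℝ, ℝ) ∞ ρ p) :
    DForm.SmoothAt (I := I) (fun x => ρ x • η x) p := by
  have h1 : ContDiffAt ℝ ∞ (ρ ∘ (extChartAt I p).symm) (extChartAt I p p) := by
    rw [← contMDiffAt_iff_contDiffAt]
    have h1 : ContMDiffAt 𝓘(ℝ, E) I ∞ (extChartAt I p).symm (extChartAt I p p) :=
      (contMDiffOn_extChartAt_symm (n := ∞) p).contMDiffAt
        ((isOpen_extChartAt_target p).mem_nhds (mem_extChartAt_target p))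
    exact ContMDiffAt.comp _ (by rwa [extChartAt_to_inv]) h1
  exact ContDiffAt.smul h1 h

/-- The differential of a function, as a `1`-form. -/
def DForm.ofFun (I : ModelWithCorners ℝ E H) (f : N → ℝ) : DForm I N 1 := fun p =>
  ContinuousAlternatingMap.ofSubsingleton ℝ _ ℝ (0 : Fin 1) (mfderiv I 𝓘(ℝ, ℝ) f p)

/-- The form `dt` on the real line. -/
def lineForm : DForm 𝓘(ℝ, ℝ) ℝ 1 := fun _ =>
  ContinuousAlternatingMap.ofSubsingleton ℝ ℝ ℝ (0 : Fin 1) (ContinuousLinearMap.id ℝ ℝ)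

/-- As a pullback of the constant form dt, the form df inherits smoothness and closedness. -/
theorem DForm.ofFun_eq (f : N → ℝ) : DForm.ofFun I f = lineForm.pullback I f := rfl

theorem lineForm_inChart (t : ℝ) : lineForm.inChart t = fun _ =>
    (ContinuousAlternatingMap.ofSubsingleton ℝ ℝ ℝ (0 : Fin 1) (ContinuousLinearMap.id ℝ ℝ)) := by
  funext s
  refine ContinuousAlternatingMap.ext fun v => ?_
  change mfderiv 𝓘(ℝ, ℝ) 𝓘(ℝ, ℝ) (extChartAt 𝓘(ℝ, ℝ) t).symm s (v 0) = v 0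
  have : ((extChartAt 𝓘(ℝ, ℝ) t).symm : ℝ → ℝ) = id := by simp; rfl
  rw [this, mfderiv_id]
  rfl

theorem lineForm_smoothAt (t : ℝ) : lineForm.SmoothAt t := by
  unfold DForm.SmoothAt
  rw [lineForm_inChart]
  exact contDiffAt_const

theorem lineForm_d (t : ℝ) : lineForm.d t = 0 := by
  unfold DForm.d
  rw [lineForm_inChart]
  have : extDeriv (fun _ : ℝ => (ContinuousAlternatingMap.ofSubsingleton ℝ ℝ ℝ (0 : Fin 1)
    (ContinuousLinearMap.id ℝ ℝ))) (extChartAt 𝓘(ℝ, ℝ) t t) = 0 := by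
    simp [extDeriv]
    exact map_zero (ContinuousAlternatingMap.alternatizeUncurryFinCLM ℝ ℝ ℝ)
  rw [this]
  rfl

theorem DForm.ofFun_smoothAt [I.Boundaryless] [IsManifold I ∞ N] {f : N → ℝ} {p : N}
    (hf : ContMDiffAt I 𝓘(ℝ, ℝ) ∞ f p) : (DForm.ofFun I f).SmoothAt p :=
  (lineForm_smoothAt (f p)).pullback hf

theorem DForm.d_ofFun [I.Boundaryless] [IsManifold I ∞ N] {f : N → ℝ} {p : N}
    (hf : ContMDiffAt I 𝓘(ℝ, ℝ) ∞ f p) : (DForm.ofFun I f).d p = 0 := by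
  rw [DForm.ofFun_eq, DForm.d_pullback (lineForm_smoothAt (f p)) hf]
  unfold DForm.pullback
  rw [lineForm_d]
  rfl

end Naturality

/-! ### Local structure of a principal circle bundle and of its connections -/

section CircleBundle

set_option linter.unusedSectionVars false

variable {M : Type*} [TopologicalSpace M] [ChartedSpace (EuclideanSpace ℝ (Fin 2)) M]
  {EP : Type*} [NormedAddCommGroup EP] [NormedSpace ℝ EP]
  {HP : Type*} [TopologicalSpace HP] {IP : ModelWithCorners ℝ EP HP}
  {P : Type*} [TopologicalSpace P] [ChartedSpace HP P] [MulAction Circle P] {pr : P → M}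

variable (IP) in
/-- A smooth equivariant local trivialization of a principal circle bundle. -/
structure IsSmoothEquivariant (e : Trivialization Circle pr) : Prop where
  smooth : ContMDiffOn IP ((𝓡 2).prod (𝓡 1)) ∞ e e.source
  smooth_symm : ContMDiffOn ((𝓡 2).prod (𝓡 1)) IP ∞ e.toOpenPartialHomeomorph.symm e.target
  equivariant : ∀ (z : Circle) (p : P), p ∈ e.source →
    z • p ∈ e.source ∧ e (z • p) = ((e p).1, z * (e p).2)

/-- The local section on which the fibre coordinate of a local trivialization is `1`. -/
def unitSection (e : Trivialization Circle pr) (x : M) : P := e.toOpenPartialHomeomorph.symm (x, 1)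

/-- The angle between the fibre coordinate of a point and a reference value. -/
def fibreAngle (e : Trivialization Circle pr) (z₀ : Circle) (p : P) : ℝ :=
  Complex.arg ((((e p).2 * z₀⁻¹ : Circle)) : ℂ)

theorem contMDiff_circle_coe : ContMDiff (𝓡 1) 𝓘(ℝ, ℂ) ∞ (fun z : Circle => (z : ℂ)) :=
  haveI : Fact (Module.finrank ℝ ℂ = 1 + 1) := finrank_real_complex_fact'
  contMDiff_coe_sphere

theorem contMDiffAt_arg_circle {z : Circle} (hz : (z : ℂ) ∈ Complex.slitPlane) :
    ContMDiffAt (𝓡 1) 𝓘(ℝ, ℝ) ∞ (fun w : Circle => Complex.arg (w : ℂ)) z := by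
  have h1 : ContDiffAt ℝ ∞ Complex.arg (z : ℂ) := by
    have h2 : ContDiffAt ℝ ∞ Complex.log (z : ℂ) := (Complex.contDiffAt_log hz).restrict_scalars ℝ
    have h3 := (Complex.imCLM.contDiff (n := ∞)).contDiffAt.comp (z : ℂ) h2
    refine h3.congr_of_eventuallyEq (Eventually.of_forall fun w => ?_)
    simp [Complex.log_im]
  exact ContMDiffAt.comp z h1.contMDiffAt (contMDiff_circle_coe z)

variable {e : Trivialization Circle pr}

theorem exp_fibreAngle_mul (p : P) (z₀ : Circle) :
    Circle.exp (fibreAngle e z₀ p) * z₀ = (e p).2 := by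
  rw [fibreAngle, Circle.exp_arg, inv_mul_cancel_right]

theorem unitSection_mem {x : M} (hx : x ∈ e.baseSet) : unitSection e x ∈ e.source :=
  e.map_target (by rwa [e.mem_target])

theorem apply_unitSection {x : M} (hx : x ∈ e.baseSet) : e (unitSection e x) = (x, 1) :=
  e.apply_symm_apply (by rwa [e.mem_target])

theorem proj_unitSection {x : M} (hx : x ∈ e.baseSet) : pr (unitSection e x) = x :=
  e.proj_symm_apply (by rwa [e.mem_target])

namespace IsSmoothEquivariant

variable (he : IsSmoothEquivariant IP e)
include he

theorem symm_eq_smul {x : M} (hx : x ∈ e.baseSet) (z : Circle) :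
    e.toOpenPartialHomeomorph.symm (x, z) = z • unitSection e x := by
  have h := he.equivariant z _ (unitSection_mem hx)
  have ht : (x, z) ∈ e.target := by rwa [e.mem_target]
  apply e.injOn (e.map_target ht) h.1
  refine (e.apply_symm_apply ht).trans (Eq.trans ?_ h.2.symm)
  rw [apply_unitSection hx, mul_one]

theorem eq_smul {p : P} (hp : p ∈ e.source) : (e p).2 • unitSection e (pr p) = p := by
  have hx := e.mem_source.1 hp
  rw [← he.symm_eq_smul hx]
  exact e.symm_apply_mk_proj hp

theorem contMDiffAt {p : P} (hp : p ∈ e.source) : ContMDiffAt IP ((𝓡 2).prod (𝓡 1)) ∞ e p :=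
  he.smooth.contMDiffAt (e.open_source.mem_nhds hp)

theorem contMDiffAt_proj {p : P} (hp : p ∈ e.source) : ContMDiffAt IP (𝓡 2) ∞ pr p := by
  refine (contMDiffAt_fst.comp p (he.contMDiffAt hp)).congr_of_eventuallyEq ?_
  filter_upwards [e.open_source.mem_nhds hp] with q hq
  exact (e.coe_fst hq).symm

theorem contMDiffAt_symm {x : M} (hx : x ∈ e.baseSet) (z : Circle) :
    ContMDiffAt ((𝓡 2).prod (𝓡 1)) IP ∞ e.toOpenPartialHomeomorph.symm (x, z) :=
  he.smooth_symm.contMDiffAt (e.open_target.mem_nhds (by rwa [e.mem_target]))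

theorem contMDiffAt_unitSection {x : M} (hx : x ∈ e.baseSet) :
    ContMDiffAt (𝓡 2) IP ∞ (unitSection e) x :=
  (he.contMDiffAt_symm hx 1).comp x (contMDiffAt_id.prodMk contMDiffAt_const)

/-- Smoothness of the action is not a hypothesis: in the trivialization the action is multiplication
in the circle. -/
theorem contMDiffAt_smul {p : P} (hp : p ∈ e.source) (z : Circle) :
    ContMDiffAt ((𝓡 1).prod IP) IP ∞ (fun q : Circle × P => q.1 • q.2) (z, p) := by
  have h1 : ContMDiffAt ((𝓡 1).prod IP) ((𝓡 2).prod (𝓡 1)) ∞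
      (fun q : Circle × P => (pr q.2, q.1 * (e q.2).2)) (z, p) := by
    refine ((he.contMDiffAt_proj hp).comp (z, p) contMDiffAt_snd).prodMk ?_
    exact contMDiffAt_fst.mul (contMDiffAt_snd.comp (z, p)
      ((he.contMDiffAt hp).comp (z, p) contMDiffAt_snd))
  have h2 := (he.contMDiffAt_symm (e.mem_source.1 hp) (z * (e p).2)).comp (z, p) h1
  refine h2.congr_of_eventuallyEq ?_
  filter_upwards [continuousAt_snd (e.open_source.mem_nhds hp)] with q hq
  rw [Function.comp_apply, he.symm_eq_smul (e.mem_source.1 hq), mul_smul, he.eq_smul hq]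

theorem contMDiffAt_fibreAngle {p : P} (hp : p ∈ e.source) {z₀ : Circle}
    (hz : (((e p).2 * z₀⁻¹ : Circle) : ℂ) ∈ Complex.slitPlane) :
    ContMDiffAt IP 𝓘(ℝ, ℝ) ∞ (fibreAngle e z₀) p := by
  have h1 : ContMDiffAt IP (𝓡 1) ∞ (fun q => (e q).2 * z₀⁻¹) p :=
    (contMDiffAt_snd.comp p (he.contMDiffAt hp)).mul contMDiffAt_const
  exact ContMDiffAt.comp (g := fun w : Circle => Complex.arg (w : ℂ)) p
    (contMDiffAt_arg_circle hz) h1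

theorem exp_fibreAngle_smul {p : P} (hp : p ∈ e.source) (z₀ : Circle) :
    (Circle.exp (fibreAngle e z₀ p) * z₀) • unitSection e (pr p) = p := by
  rw [exp_fibreAngle_mul, he.eq_smul hp]

theorem mfderiv_proj_unitSection {x : M} (hx : x ∈ e.baseSet) (v : EuclideanSpace ℝ (Fin 2)) :
    (mfderiv IP (𝓡 2) pr (unitSection e x) (mfderiv (𝓡 2) IP (unitSection e) x v) :
      EuclideanSpace ℝ (Fin 2)) = v := by
  have h1 := mfderiv_comp_apply x
    ((he.contMDiffAt_proj (unitSection_mem hx)).mdifferentiableAt (by simp))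
    ((he.contMDiffAt_unitSection hx).mdifferentiableAt (by simp)) v
  have h2 : pr ∘ unitSection e =ᶠ[𝓝 x] id := by
    filter_upwards [e.open_baseSet.mem_nhds hx] with y hy using proj_unitSection hy
  rw [h2.mfderiv_eq, mfderiv_id] at h1
  exact h1.symm

/-- The unit section is a right inverse of `pr`, so the derivative of `pr` is onto along it and
pullback by `pr` is injective there. This gives uniqueness of the curvature. -/
theorem eq_of_pullback_proj_eq {k : ℕ} {η η' : DForm (𝓡 2) M k} {x : M} (hx : x ∈ e.baseSet)
    (h : η.pullback IP pr (unitSection e x) = η'.pullback IP pr (unitSection e x)) :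
    η x = η' x := by
  refine ContinuousAlternatingMap.ext fun v => ?_
  have h1 := congrArg (fun L : EP [⋀^Fin k]→L[ℝ] ℝ =>
    L (fun i => mfderiv (𝓡 2) IP (unitSection e) x (v i))) h
  have h2 : ∀ ζ : DForm (𝓡 2) M k, ζ.pullback IP pr (unitSection e x)
      (fun i => mfderiv (𝓡 2) IP (unitSection e) x (v i)) = ζ x v := by
    intro ζ
    refine Eq.trans ?_ (ζ.apply_eq_of_eq (proj_unitSection hx) v)
    change ζ _ (fun i => _) = ζ _ _
    congr 1
    funext i
    exact he.mfderiv_proj_unitSection hx (v i)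
  exact (h2 η).symm.trans (h1.trans (h2 η'))

/-- The normalisation `vertical` moved from time `0` to time `a`, so that it applies to the fibre
through `p` parametrised by its angle. -/
theorem _root_.YMSurface.CircleConnection.form_generator (A : CircleConnection IP P) {p : P}
    (hp : p ∈ e.source) (a : ℝ) :
    A.form p (fun _ => mfderiv 𝓘(ℝ, ℝ) IP (fun t : ℝ => Circle.exp (t - a) • p) a (1 : ℝ)) = 1 := by
  have h1 : MDifferentiableAt 𝓘(ℝ, ℝ) IP (fun t : ℝ => Circle.exp t • p) 0 := by
    have := (he.contMDiffAt_smul hp (Circle.exp 0)).comp (0 : ℝ)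
      ((contMDiff_circleExp (0 : ℝ)).prodMk contMDiffAt_const)
    exact this.mdifferentiableAt (by simp)
  have h2 : HasMFDerivAt 𝓘(ℝ, ℝ) 𝓘(ℝ, ℝ) (fun t : ℝ => t - a) a (ContinuousLinearMap.id ℝ ℝ) :=
    ((hasFDerivAt_id a).sub_const a).hasMFDerivAt
  have h3 := mfderiv_comp_apply_of_eq (f := fun t : ℝ => t - a) a h1 h2.mdifferentiableAt
    (sub_self a) (1 : ℝ)
  rw [h2.mfderiv] at h3
  refine Eq.trans ?_ ((A.form.apply_eq_of_eq (x := p) (by simp) _).trans (A.vertical p))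
  change A.form p (fun _ => _) = A.form p (fun _ => _)
  congr 1
  funext _
  exact h3

/-- A tangent vector splits into a part that moves the angle over a fixed base point and a part that
moves the base point at a fixed angle. On the first A is dθ by normalisation; on the second it is
s^*A by invariance, since the curve is a translate of one in the section. The condition `hz` keeps
the angle off the branch cut. -/
theorem form_eq (A : CircleConnection IP P) {p : P} (hp : p ∈ e.source) {z₀ : Circle}
    (hz : (((e p).2 * z₀⁻¹ : Circle) : ℂ) ∈ Complex.slitPlane) :
    A.form p = (A.form.pullback (𝓡 2) (unitSection e)).pullback IP pr p +
      DForm.ofFun IP (fibreAngle e z₀) p := by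
  set θ := fibreAngle e z₀
  have hx := e.mem_source.1 hp
  -- The parametrisation of P by angle and base point, a left inverse near `p` of `(θ, pr)`.
  let μ : ℝ × M → P := fun q => e.toOpenPartialHomeomorph.symm (q.2, Circle.exp q.1 * z₀)
  have hθ := (he.contMDiffAt_fibreAngle hp hz).mdifferentiableAt (by simp)
  have hpr := (he.contMDiffAt_proj hp).mdifferentiableAt (by simp)
  have hμ : MDifferentiableAt (𝓘(ℝ, ℝ).prod (𝓡 2)) IP μ (θ p, pr p) := by
    refine ContMDiffAt.mdifferentiableAt (n := ∞) ?_ (by simp)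
    refine (he.contMDiffAt_symm hx (Circle.exp (θ p) * z₀)).comp (θ p, pr p) ?_
    exact contMDiffAt_snd.prodMk
      (((contMDiff_circleExp (θ p)).comp (θ p, pr p) contMDiffAt_fst).mul contMDiffAt_const)
  have hid : μ ∘ (fun q => (θ q, pr q)) =ᶠ[𝓝 p] id := by
    filter_upwards [e.open_source.mem_nhds hp] with q hq
    change e.toOpenPartialHomeomorph.symm (pr q, Circle.exp (θ q) * z₀) = q
    rw [he.symm_eq_smul (e.mem_source.1 hq), he.exp_fibreAngle_smul hq]
  have hexp : (Circle.exp (θ p) * z₀) • unitSection e (pr p) = p := he.exp_fibreAngle_smul hp z₀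
  have hs := (he.contMDiffAt_unitSection hx).mdifferentiableAt (by simp)
  -- The chain rule for `μ ∘ (θ, pr) = id`, with the derivative of `μ` written as the sum of its
  -- partial derivatives.
  have hdecomp : ∀ v : EP, v =
      (mfderiv 𝓘(ℝ, ℝ) IP (fun t => μ (t, pr p)) (θ p) (mfderiv IP 𝓘(ℝ, ℝ) θ p v) : EP) +
      mfderiv (𝓡 2) IP (fun x => μ (θ p, x)) (pr p) (mfderiv IP (𝓡 2) pr p v) := by
    intro v
    have h1 := mfderiv_comp_apply p hμ (hθ.prodMk hpr) v
    rw [hid.mfderiv_eq, mfderiv_id, mfderiv_prod_eq_add_apply hμ, mfderiv_prodMk hθ hpr] at h1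
    exact h1
  have ht : (fun t => μ (t, pr p)) = fun t => Circle.exp (t - θ p) • p := by
    funext t
    change e.toOpenPartialHomeomorph.symm (pr p, Circle.exp t * z₀) = _
    rw [he.symm_eq_smul hx]
    refine Eq.trans ?_ (congrArg (fun q => Circle.exp (t - θ p) • q) hexp)
    rw [smul_smul, ← mul_assoc, ← Circle.exp_add, sub_add_cancel]
  have hxd : ∀ w : EuclideanSpace ℝ (Fin 2),
      (mfderiv (𝓡 2) IP (fun x => μ (θ p, x)) (pr p) w : EP) =
        mfderiv IP IP (fun q : P => (e p).2 • q) (unitSection e (pr p))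
          (mfderiv (𝓡 2) IP (unitSection e) (pr p) w) := by
    intro w
    have h0 : (fun x => μ (θ p, x)) =ᶠ[𝓝 (pr p)]
        (fun q : P => (e p).2 • q) ∘ unitSection e := by
      filter_upwards [e.open_baseSet.mem_nhds hx] with y hy
      change e.toOpenPartialHomeomorph.symm (y, Circle.exp (θ p) * z₀) = _
      rw [he.symm_eq_smul hy]
      exact congrArg (· • unitSection e y) (exp_fibreAngle_mul p z₀)
    rw [h0.mfderiv_eq]
    refine mfderiv_comp_apply (pr p) ?_ hs w
    have := (he.contMDiffAt_smul (unitSection_mem hx) (e p).2).comp (unitSection e (pr p))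
      (contMDiffAt_const.prodMk contMDiffAt_id)
    exact this.mdifferentiableAt (by simp)
  refine ContinuousAlternatingMap.ext fun v => ?_
  let Ap : EP →L[ℝ] ℝ :=
    (ContinuousAlternatingMap.ofSubsingleton ℝ EP ℝ (0 : Fin 1)).symm (A.form p)
  have hAp : ∀ w : Fin 1 → EP, A.form p w = Ap (w 0) := by
    intro w
    have : w = fun _ => w 0 := by funext i; rw [Subsingleton.elim i 0]
    rw [this]
    rfl
  have hA1 : ∀ c : ℝ, Ap (mfderiv 𝓘(ℝ, ℝ) IP (fun t => μ (t, pr p)) (θ p) c) = c := by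
    intro c
    have h1 := A.form_generator he hp (θ p)
    rw [← ht] at h1
    have h2 : (mfderiv 𝓘(ℝ, ℝ) IP (fun t => μ (t, pr p)) (θ p) c : EP) =
        c • (mfderiv 𝓘(ℝ, ℝ) IP (fun t => μ (t, pr p)) (θ p) (1 : ℝ) : EP) := by
      have := (mfderiv 𝓘(ℝ, ℝ) IP (fun t => μ (t, pr p)) (θ p)).map_smul c (1 : ℝ)
      refine Eq.trans ?_ this
      congr 1
      exact (mul_one c).symm
    refine (congrArg Ap h2).trans ?_
    refine (Ap.map_smul c _).trans ?_
    have h3 : Ap (mfderiv 𝓘(ℝ, ℝ) IP (fun t => μ (t, pr p)) (θ p) (1 : ℝ)) = 1 :=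
      (hAp _).symm.trans h1
    exact (congrArg (fun r => c • r) h3).trans (mul_one c)
  have hA2 : ∀ w : EuclideanSpace ℝ (Fin 2),
      Ap (mfderiv (𝓡 2) IP (fun x => μ (θ p, x)) (pr p) w) =
        A.form.pullback (𝓡 2) (unitSection e) (pr p) (fun _ => w) := by
    intro w
    have h1 := congrArg (fun L : EP [⋀^Fin 1]→L[ℝ] ℝ =>
      L (fun _ => mfderiv (𝓡 2) IP (unitSection e) (pr p) w))
      (A.invariant (e p).2 (unitSection e (pr p)))
    refine Eq.trans ?_ h1
    refine Eq.trans ?_ (A.form.apply_eq_of_eq (he.eq_smul hp) _).symm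
    refine (congrArg Ap (hxd w)).trans ?_
    exact (hAp (fun _ => _)).symm
  have hv := congrArg Ap (hdecomp (v 0))
  refine (hAp v).trans (hv.trans ?_)
  refine (map_add Ap _ _).trans ?_
  rw [add_comm]
  refine congrArg₂ (· + ·) ((hA2 _).trans ?_) ((hA1 _).trans ?_)
  · change A.form.pullback (𝓡 2) (unitSection e) (pr p) (fun _ => _) =
      A.form.pullback (𝓡 2) (unitSection e) (pr p) (fun _ => _)
    congr 1
    funext i
    rw [Subsingleton.elim i 0]
    rfl
  · rfl

end IsSmoothEquivariant

end CircleBundle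

/-! ### Existence, smoothness and comparison of curvatures -/

section Curvature

set_option linter.unusedSectionVars false

variable {M : Type*} [TopologicalSpace M] [ChartedSpace (EuclideanSpace ℝ (Fin 2)) M]
  [IsManifold (𝓡 2) ∞ M]
  {EP : Type*} [NormedAddCommGroup EP] [NormedSpace ℝ EP]
  {HP : Type*} [TopologicalSpace HP] {IP : ModelWithCorners ℝ EP HP} [IP.Boundaryless]
  {P : Type*} [TopologicalSpace P] [ChartedSpace HP P] [IsManifold IP ∞ P] [MulAction Circle P]
  {pr : P → M}

namespace IsSmoothEquivariant

variable {e : Trivialization Circle pr} (he : IsSmoothEquivariant IP e)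
include he

theorem smoothAt_pullback_unitSection (A : CircleConnection IP P) {x : M} (hx : x ∈ e.baseSet) :
    (A.form.pullback (𝓡 2) (unitSection e)).SmoothAt x :=
  (A.smooth.smoothAt _).pullback (he.contMDiffAt_unitSection hx)

theorem d_form_eq (A : CircleConnection IP P) {p : P} (hp : p ∈ e.source) :
    A.form.d p = (A.form.pullback (𝓡 2) (unitSection e)).d.pullback IP pr p := by
  -- With the fibre coordinate of `p` itself as reference value, `p` has angle `0`, away from the
  -- cut of `arg`.
  have h1 : (((e p).2 * (e p).2⁻¹ : Circle) : ℂ) ∈ Complex.slitPlane := by simp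
  have hs := he.smoothAt_pullback_unitSection A (e.mem_source.1 hp)
  have hpr := he.contMDiffAt_proj hp
  have hc : ContinuousAt (fun q => (((e q).2 * (e p).2⁻¹ : Circle) : ℂ)) p := by
    have := (continuous_snd.continuousAt.comp (he.contMDiffAt hp).continuousAt).mul_const
      ((e p).2⁻¹)
    exact contMDiff_circle_coe.continuous.continuousAt.comp this
  have hev : ∀ᶠ q in 𝓝 p, A.form q =
      (A.form.pullback (𝓡 2) (unitSection e)).pullback IP pr q +
        DForm.ofFun IP (fibreAngle e (e p).2) q := by
    filter_upwards [e.open_source.mem_nhds hp,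
      hc.eventually (Complex.isOpen_slitPlane.mem_nhds h1)] with q hq hq1
    exact he.form_eq A hq hq1
  have hθ := he.contMDiffAt_fibreAngle hp h1
  rw [DForm.d_congr hev, DForm.d_add (hs.pullback hpr) (DForm.ofFun_smoothAt hθ),
    DForm.d_ofFun hθ, add_zero, DForm.d_pullback hs hpr]

theorem eq_d_of_isCurvature {A : CircleConnection IP P} {F : DForm (𝓡 2) M 2}
    (hF : A.IsCurvature pr F) {x : M} (hx : x ∈ e.baseSet) :
    F x = (A.form.pullback (𝓡 2) (unitSection e)).d x := by
  apply he.eq_of_pullback_proj_eq hx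
  rw [← he.d_form_eq A (unitSection_mem hx)]
  exact (hF _).symm

end IsSmoothEquivariant

theorem IsPrincipalCircleBundle.exists_trivialization (hpr : IsPrincipalCircleBundle IP pr)
    (x : M) : ∃ e : Trivialization Circle pr, x ∈ e.baseSet ∧ IsSmoothEquivariant IP e := by
  obtain ⟨e, hx, h1, h2, h3⟩ := hpr x
  exact ⟨e, hx, h1, h2, h3⟩

/-- No gluing is needed: the defining identity is pointwise, and the trivialization chosen at `pr p`
covers the whole fibre of `p`. -/
theorem IsPrincipalCircleBundle.exists_isCurvature (hpr : IsPrincipalCircleBundle IP pr)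
    (A : CircleConnection IP P) : ∃ F : DForm (𝓡 2) M 2, A.IsCurvature pr F := by
  choose e hx he using hpr.exists_trivialization
  refine ⟨fun x => (A.form.pullback (𝓡 2) (unitSection (e x))).d x, fun p => ?_⟩
  exact (he (pr p)).d_form_eq A ((e (pr p)).mem_source.2 (hx (pr p)))

theorem IsPrincipalCircleBundle.isCurvature_curvature (hpr : IsPrincipalCircleBundle IP pr)
    (A : CircleConnection IP P) : A.IsCurvature pr (A.curvature pr) := by
  have h := hpr.exists_isCurvature A
  unfold CircleConnection.curvature
  rw [dif_pos h]
  exact h.choose_spec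

/-- The curvature is obtained by choice, but by uniqueness it agrees near each point with d(s^*A)
for a single smooth section s. -/
theorem IsPrincipalCircleBundle.contDiffAt_curvature (hpr : IsPrincipalCircleBundle IP pr)
    (A : CircleConnection IP P) {x₀ : M} {u : EuclideanSpace ℝ (Fin 2)}
    (hu : u ∈ (extChartAt (𝓡 2) x₀).target) :
    ContDiffAt ℝ ∞ ((A.curvature pr).inChart x₀) u := by
  obtain ⟨e, hx, he⟩ := hpr.exists_trivialization ((extChartAt (𝓡 2) x₀).symm u)
  have hb := e.open_baseSet.mem_nhds hx
  have h1 := DForm.contDiffAt_inChart_d (η := A.form.pullback (𝓡 2) (unitSection e)) hu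
    (by filter_upwards [hb] with y hy using he.smoothAt_pullback_unitSection A hy)
  refine h1.congr_of_eventuallyEq (DForm.inChart_congr hu ?_)
  filter_upwards [hb] with y hy
  exact he.eq_d_of_isCurvature (hpr.isCurvature_curvature A) hy

/-- The curvatures of two connections differ by an exact form. -/
theorem IsPrincipalCircleBundle.exists_curvature_eq_add (hpr : IsPrincipalCircleBundle IP pr)
    (A A' : CircleConnection IP P) : ∃ α : DForm (𝓡 2) M 1, (∀ x, α.SmoothAt x) ∧
      ∀ x, A'.curvature pr x = A.curvature pr x + α.d x := by
  let a : (B : CircleConnection IP P) → (e : Trivialization Circle pr) → DForm (𝓡 2) M 1 :=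
    fun B e => B.form.pullback (𝓡 2) (unitSection e)
  let δ : Trivialization Circle pr → DForm (𝓡 2) M 1 := fun e x => a A' e x + -a A e x
  -- The terms dθ depend on the trivialization only and cancel in A' - A.
  have hδ : ∀ e : Trivialization Circle pr, IsSmoothEquivariant IP e → ∀ p ∈ e.source,
      A'.form p + -A.form p = (δ e).pullback IP pr p := by
    intro e he p hp
    have h1 : (((e p).2 * (e p).2⁻¹ : Circle) : ℂ) ∈ Complex.slitPlane := by simp
    rw [he.form_eq A' hp h1, he.form_eq A hp h1, neg_add, add_add_add_comm, add_neg_cancel,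
      add_zero]
    rfl
  choose e hx he using hpr.exists_trivialization
  let α : DForm (𝓡 2) M 1 := fun x => δ (e x) x
  -- `α` uses a different trivialization at each point. All the local forms pull back to the same A'
  -- - A, so by injectivity of the pullback they agree on overlaps.
  have hα : ∀ x, ∀ᶠ y in 𝓝 x, α y = δ (e x) y := by
    intro x
    filter_upwards [(e x).open_baseSet.mem_nhds (hx x)] with y hy
    refine (he x).eq_of_pullback_proj_eq hy ?_
    rw [← hδ (e x) (he x) _ (unitSection_mem hy)]
    have hy' : unitSection (e x) y ∈ (e y).source :=
      (e y).mem_source.2 (by rw [proj_unitSection hy]; exact hx y)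
    rw [hδ (e y) (he y) _ hy']
    have : ∀ z, z = y → α z = δ (e y) z := by rintro z rfl; rfl
    unfold DForm.pullback
    rw [this _ (proj_unitSection hy)]
  have hs : ∀ B x, (a B (e x)).SmoothAt x := fun B x =>
    (he x).smoothAt_pullback_unitSection B (hx x)
  refine ⟨α, fun x => ((hs A' x).add (hs A x).neg).congr (hα x), fun x => ?_⟩
  rw [DForm.d_congr (hα x), DForm.d_add (hs A' x) (hs A x).neg, DForm.d_neg,
    (he x).eq_d_of_isCurvature (hpr.isCurvature_curvature A) (hx x),
    (he x).eq_d_of_isCurvature (hpr.isCurvature_curvature A') (hx x)]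
  exact (add_neg_cancel_comm_assoc _ _).symm

end Curvature

/-! ### Linear algebra and Stokes' theorem in the plane -/

section Integration

set_option linter.unusedSectionVars false

/-- The model plane of a surface. -/
abbrev Plane := EuclideanSpace ℝ (Fin 2)

/-- The standard frame of the model plane. -/
def stdFrame : Fin 2 → Plane := fun i => EuclideanSpace.single i 1

/-- The standard basis of the model plane. -/
def stdBasis : Module.Basis (Fin 2) ℝ Plane := (EuclideanSpace.basisFun (Fin 2) ℝ).toBasis

theorem coe_stdBasis : (stdBasis : Fin 2 → Plane) = stdFrame := by
  funext i
  simp [stdBasis, stdFrame]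

theorem alternating_comp (ω' : Plane [⋀^Fin 2]→ₗ[ℝ] ℝ) (L : Plane →L[ℝ] Plane) :
    ω' (fun i => L (stdFrame i)) = L.det * ω' stdFrame := by
  rw [ω'.eq_smul_basis_det stdBasis]
  have h := stdBasis.det_comp (L : Plane →ₗ[ℝ] Plane) stdFrame
  have h1 : stdBasis.det stdFrame = 1 := by rw [← coe_stdBasis]; exact stdBasis.det_self
  simp only [AlternatingMap.smul_apply, smul_eq_mul]
  have h2 : stdBasis.det (fun i => L (stdFrame i)) = L.det * stdBasis.det stdFrame := h
  rw [h2]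
  ring

theorem alternating_eq_zero {ω' : Plane [⋀^Fin 2]→ₗ[ℝ] ℝ} (h : ω' stdFrame = 0) : ω' = 0 := by
  rw [ω'.eq_smul_basis_det stdBasis, coe_stdBasis, h, zero_smul]

/-! #### Integrals in the plane -/

/-- Integration by parts against the constant function `1`. -/
theorem integral_fderiv_eq_zero {V : Type*} [NormedAddCommGroup V] [NormedSpace ℝ V]
    [FiniteDimensional ℝ V] [MeasurableSpace V] [BorelSpace V] (μ : Measure V) [μ.IsAddHaarMeasure]
    {b : V → ℝ} (hb : ContDiff ℝ 1 b) (hc : HasCompactSupport b) (v : V) :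
    ∫ u, fderiv ℝ b u v ∂μ = 0 := by
  have hcont : Continuous (fun u => fderiv ℝ b u v) :=
    (hb.continuous_fderiv (by simp)).clm_apply continuous_const
  have hcs : HasCompactSupport (fun u => fderiv ℝ b u v) :=
    (hc.fderiv ℝ).comp_left (g := fun L : V →L[ℝ] ℝ => L v) rfl
  have h := integral_mul_fderiv_eq_neg_fderiv_mul_of_integrable (μ := μ) (f := fun _ : V => (1 : ℝ))
    (g := b) (v := v) (by simp) (by simpa using hcont.integrable_of_hasCompactSupport hcs)
    (by simpa using hb.continuous.integrable_of_hasCompactSupport hc)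
    (fun x _ => differentiableAt_const _) (fun x _ => hb.differentiable (by simp) x)
  simpa using h

theorem integrableOn_of_continuousOn_of_compact {V : Type*} [TopologicalSpace V] [T2Space V]
    [MeasurableSpace V] [OpensMeasurableSpace V] {μ : Measure V} [IsFiniteMeasureOnCompacts μ]
    {f : V → ℝ} {U K : Set V} (hU : IsOpen U) (hK : IsCompact K) (hKU : K ⊆ U)
    (hf : ContinuousOn f U) (h0 : ∀ u ∈ U, u ∉ K → f u = 0) : IntegrableOn f U μ :=
  ((hf.mono hKU).integrableOn_compact hK).of_forall_sdiff_eq_zero hU.measurableSet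
    fun u hu => h0 u hu.1 hu.2

/-- Stokes' theorem for a `1`-form with compact support in an open subset of the plane, weighted by a
locally constant function. -/
theorem integral_extDeriv_eq_zero {U K : Set Plane} (hU : IsOpen U) (hK : IsCompact K)
    (hKU : K ⊆ U) {ε : Plane → ℝ} (hε : ∀ u ∈ U, ∀ᶠ w in 𝓝 u, ε w = ε u)
    {β : Plane → Plane [⋀^Fin 1]→L[ℝ] ℝ} (hβ : ∀ u ∈ U, ContDiffAt ℝ ∞ β u)
    (h0 : ∀ u ∈ U, u ∉ K → β u = 0) :
    ∫ u in U, ε u * extDeriv β u stdFrame = 0 := by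
  classical
  -- The coefficient of `β` along `v`, weighted by `ε` and extended by zero; it is C¹ on the whole
  -- plane because it vanishes off the compact set `K ⊆ U`.
  let b : Plane → Plane → ℝ := fun v => U.indicator fun u => ε u * β u (fun _ => v)
  have hloc : ∀ v, ∀ u ∈ U, b v =ᶠ[𝓝 u] fun w => ε u * β w (fun _ => v) := by
    intro v u hu
    filter_upwards [hU.mem_nhds hu, hε u hu] with w hw hw'
    simp only [b, indicator_of_mem hw, hw']
  have hout : ∀ v, ∀ u ∉ K, b v =ᶠ[𝓝 u] fun _ => 0 := by
    intro v u hu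
    filter_upwards [hK.isClosed.isOpen_compl.mem_nhds hu] with w hw
    by_cases hwU : w ∈ U
    · simp only [b, indicator_of_mem hwU, h0 w hwU hw]
      simp
    · simp only [b, indicator_of_notMem hwU]
  have happ : ∀ v, ∀ u ∈ U, ContDiffAt ℝ ∞ (fun w => β w (fun _ => v)) u := fun v u hu =>
    (ContinuousAlternatingMap.apply ℝ Plane ℝ (fun _ : Fin 1 => v)).contDiff.contDiffAt.comp u
      (hβ u hu)
  have hsm : ∀ v, ContDiff ℝ 1 (b v) := by
    intro v
    rw [contDiff_iff_contDiffAt]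
    intro u
    by_cases hu : u ∈ U
    · exact ((contDiffAt_const.mul ((happ v u hu).of_le (by simp))).congr_of_eventuallyEq
        (hloc v u hu))
    · exact contDiffAt_const.congr_of_eventuallyEq (hout v u fun h => hu (hKU h))
  have hcs : ∀ v, HasCompactSupport (b v) := fun v =>
    HasCompactSupport.intro hK fun u hu => (hout v u hu).self_of_nhds
  have hint : ∀ v w : Plane, Integrable (fun u => fderiv ℝ (b v) u w) := by
    intro v w
    refine Continuous.integrable_of_hasCompactSupport
      (((hsm v).continuous_fderiv (by simp)).clm_apply continuous_const) ?_
    exact ((hcs v).fderiv ℝ).comp_left (g := fun L : Plane →L[ℝ] ℝ => L w) rfl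
  have hfd : ∀ v w, ∀ u ∈ U, fderiv ℝ (b v) u w = ε u * fderiv ℝ (fun y => β y (fun _ => v)) u w := by
    intro v w u hu
    rw [(hloc v u hu).fderiv_eq, fderiv_const_mul ((happ v u hu).differentiableAt (by simp))]
    rfl
  -- dβ(∂₁, ∂₂) = ∂₁β₂ - ∂₂β₁, and the locally constant `ε` passes under the derivatives.
  have hkey : ∀ u ∈ U, ε u * extDeriv β u stdFrame =
      fderiv ℝ (b (stdFrame 1)) u (stdFrame 0) - fderiv ℝ (b (stdFrame 0)) u (stdFrame 1) := by
    intro u hu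
    rw [hfd _ _ u hu, hfd _ _ u hu, extDeriv_apply ((hβ u hu).differentiableAt (by simp)),
      Fin.sum_univ_two]
    have e0 : (Fin.removeNth (0 : Fin 2) stdFrame : Fin 1 → Plane) = fun _ => stdFrame 1 := by
      funext i; fin_cases i; rfl
    have e1 : (Fin.removeNth (1 : Fin 2) stdFrame : Fin 1 → Plane) = fun _ => stdFrame 0 := by
      funext i; fin_cases i; rfl
    rw [e0, e1]
    simp
    ring
  rw [setIntegral_congr_fun hU.measurableSet hkey, setIntegral_eq_integral_of_forall_compl_eq_zero,
    integral_sub (hint _ _) (hint _ _), integral_fderiv_eq_zero _ (hsm _) (hcs _),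
    integral_fderiv_eq_zero _ (hsm _) (hcs _), sub_zero]
  intro u hu
  have hu' : u ∉ K := fun h => hu (hKU h)
  rw [(hout _ u hu').fderiv_eq, (hout _ u hu').fderiv_eq]
  simp

end Integration

/-! ### Integrals of 2-forms over chart domains and change of charts -/

section FormIntegral

set_option linter.unusedSectionVars false

variable {M : Type*} [TopologicalSpace M] [ChartedSpace (EuclideanSpace ℝ (Fin 2)) M]

theorem sign_someVector_eq {V : Type*} [AddCommGroup V] [Module ℝ V]
    (o : Orientation ℝ V (Fin 2)) (ω' : V [⋀^Fin 2]→ₗ[ℝ] ℝ) (hω : ω' ≠ 0)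
    (h : rayOfNeZero ℝ ω' hω = o) (v : Fin 2 → V) : frameSign o v = SignType.sign (ω' v) := by
  rw [← o.someVector_ray, ray_eq_iff] at h
  obtain ⟨r₁, r₂, h₁, h₂, h⟩ := h.exists_pos hω o.someVector_ne_zero
  have h' : r₁ * ω' v = r₂ * o.someVector v := by
    simpa using congrArg (fun L : V [⋀^Fin 2]→ₗ[ℝ] ℝ => L v) h
  have := congrArg SignType.sign h'
  rw [sign_mul, sign_mul, sign_pos h₁, sign_pos h₂, one_mul, one_mul] at this
  exact this.symm

/-- The sign of the coordinate frame, as a real number. -/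
def frameSgn (o : SurfaceOrientation M) (i : M) (u : Plane) : ℝ :=
  ((frameSign (o.orient ((extChartAt (𝓡 2) i).symm u)) (coordFrame i u) : SignType) : ℝ)

/-- The integral of a `2`-form over the domain of a chart. -/
def chartIntegral (o : SurfaceOrientation M) (i : M) (η : DForm (𝓡 2) M 2) : ℝ :=
  ∫ u in (extChartAt (𝓡 2) i).target, frameSgn o i u * η.inChart i u stdFrame

theorem eventually_frameSgn_eq (o : SurfaceOrientation M) {i : M} {u : Plane}
    (hu : u ∈ (extChartAt (𝓡 2) i).target) : ∀ᶠ w in 𝓝 u, frameSgn o i w = frameSgn o i u := by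
  have h := (o.continuousOn_sign i).continuousAt ((isOpen_extChartAt_target i).mem_nhds hu)
  filter_upwards [h.eventually (IsOpen.mem_nhds (isOpen_discrete {_}) rfl)] with w hw
  exact congrArg (fun s : SignType => (s : ℝ)) hw

theorem continuousOn_frameSgn (o : SurfaceOrientation M) (i : M) :
    ContinuousOn (frameSgn o i) (extChartAt (𝓡 2) i).target := fun _ hu =>
  (continuousAt_const.congr
    ((eventually_frameSgn_eq o hu).mono fun _ h => h.symm)).continuousWithinAt

section Charts

variable [IsManifold (𝓡 2) ∞ M]

/-- The transition map between two charts. -/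
def transition (i j : M) : Plane → Plane := coordMap (𝓡 2) (𝓡 2) (id : M → M) i j

/-- No regularity in `x` is required, so the same formula serves for a 2-form and for the arbitrary
representatives `someVector` of the orientations. -/
theorem family_coordFrame (ω' : ∀ x : M, TangentSpace (𝓡 2) x [⋀^Fin 2]→ₗ[ℝ] ℝ) {i j : M}
    {u : Plane} (hu : u ∈ (extChartAt (𝓡 2) i).target)
    (hj : (extChartAt (𝓡 2) i).symm u ∈ (extChartAt (𝓡 2) j).source) :
    ω' _ (coordFrame i u) =
      (fderiv ℝ (transition i j) u).det * ω' _ (coordFrame j (transition i j u)) := by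
  set w := transition i j u
  let L : Plane →L[ℝ] Plane := mfderiv 𝓘(ℝ, Plane) (𝓡 2) (extChartAt (𝓡 2) j).symm w
  let ω₀ : Plane [⋀^Fin 2]→ₗ[ℝ] ℝ := ω' ((extChartAt (𝓡 2) j).symm w)
  have h1 := alternating_comp (ω₀.compLinearMap (L : Plane →ₗ[ℝ] Plane)) (fderiv ℝ (transition i j) u)
  refine Eq.trans ?_ h1
  have e : (extChartAt (𝓡 2) i).symm u = (extChartAt (𝓡 2) j).symm w :=
    ((extChartAt (𝓡 2) j).left_inv hj).symm
  have h2 : ∀ (y : M) (_ : y = (extChartAt (𝓡 2) i).symm u) (v : Fin 2 → Plane),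
      (ω' ((extChartAt (𝓡 2) i).symm u) v : ℝ) = ω' y v := by rintro y rfl v; rfl
  refine (h2 _ e.symm (coordFrame i u)).trans ?_
  change ω₀ (fun k => _) = ω₀ (fun k => _)
  congr 1
  funext k
  have h3 := fderiv_coordMap (f := id) hu mdifferentiableAt_id hj (stdFrame k)
  rw [mfderiv_id] at h3
  have h4 := mfderiv_symm_extChartAt hj (coordFrame i u k)
  refine h4.symm.trans ?_
  exact (congrArg L h3).symm

/-- The coefficient of `η` is multiplied by the Jacobian determinant and the frame sign by its sign;
together they give the absolute value that the change of variables formula requires. -/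
theorem frameSgn_mul_inChart (o : SurfaceOrientation M) (η : DForm (𝓡 2) M 2) {i j : M}
    {u : Plane} (hu : u ∈ (extChartAt (𝓡 2) i).target)
    (hj : (extChartAt (𝓡 2) i).symm u ∈ (extChartAt (𝓡 2) j).source) :
    frameSgn o i u * η.inChart i u stdFrame = |(fderiv ℝ (transition i j) u).det| *
      (frameSgn o j (transition i j u) * η.inChart j (transition i j u) stdFrame) := by
  have h1 : η.inChart i u stdFrame =
      (fderiv ℝ (transition i j) u).det * η.inChart j (transition i j u) stdFrame :=
    family_coordFrame (fun x => (η x).toAlternatingMap) hu hj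
  have h2 := family_coordFrame (fun x => (o.orient x).someVector) hu hj
  have h3 : frameSgn o i u = (SignType.sign (fderiv ℝ (transition i j) u).det : ℝ) *
      frameSgn o j (transition i j u) := by
    unfold frameSgn frameSign
    rw [h2, sign_mul, SignType.coe_mul]
  rw [h1, h3, ← sign_mul_self]
  ring

/-- As `η` vanishes outside each of the two chart domains, both integrals reduce to the overlap,
where the transition map is an injective change of variables. -/
theorem chartIntegral_eq (o : SurfaceOrientation M) {η : DForm (𝓡 2) M 2} {i j : M}
    (hi : ∀ x ∉ (extChartAt (𝓡 2) i).source, η x = 0)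
    (hj : ∀ x ∉ (extChartAt (𝓡 2) j).source, η x = 0) :
    chartIntegral o i η = chartIntegral o j η := by
  let S : M → M → Set Plane := fun i j =>
    (extChartAt (𝓡 2) i).target ∩ (extChartAt (𝓡 2) i).symm ⁻¹' (extChartAt (𝓡 2) j).source
  have hS : ∀ i j, IsOpen (S i j) := fun i j =>
    (continuousOn_extChartAt_symm i).isOpen_inter_preimage (isOpen_extChartAt_target i)
      (isOpen_extChartAt_source j)
  have hred : ∀ i j, (∀ x ∉ (extChartAt (𝓡 2) j).source, η x = 0) → chartIntegral o i η =
      ∫ u in S i j, frameSgn o i u * η.inChart i u stdFrame := by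
    intro i j h
    refine setIntegral_eq_of_subset_of_forall_sdiff_eq_zero
      (isOpen_extChartAt_target i).measurableSet inter_subset_left ?_
    rintro u ⟨hu, hu'⟩
    have : η ((extChartAt (𝓡 2) i).symm u) = 0 := h _ fun hx => hu' ⟨hu, hx⟩
    simp only [DForm.inChart, this]
    exact mul_zero _
  rw [hred i j hj, hred j i hi]
  have hmaps : ∀ i j, ∀ u ∈ S i j, transition i j u ∈ S j i ∧
      transition j i (transition i j u) = u := by
    rintro i j u ⟨hu, hu'⟩
    have e : (extChartAt (𝓡 2) j).symm (transition i j u) = (extChartAt (𝓡 2) i).symm u :=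
      (extChartAt (𝓡 2) j).left_inv hu'
    refine ⟨⟨(extChartAt (𝓡 2) j).map_source hu', ?_⟩, ?_⟩
    · rw [mem_preimage, e]; exact (extChartAt (𝓡 2) i).map_target hu
    · change extChartAt (𝓡 2) i ((extChartAt (𝓡 2) j).symm (transition i j u)) = u
      rw [e, (extChartAt (𝓡 2) i).right_inv hu]
  have himg : transition i j '' S i j = S j i := by
    ext w
    constructor
    · rintro ⟨u, hu, rfl⟩; exact (hmaps i j u hu).1
    · intro hw; exact ⟨_, (hmaps j i w hw).1, (hmaps j i w hw).2⟩
  have hinj : InjOn (transition i j) (S i j) := fun u hu w hw h => by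
    rw [← (hmaps i j u hu).2, h, (hmaps i j w hw).2]
  have hder : ∀ u ∈ S i j, HasFDerivWithinAt (transition i j) (fderiv ℝ (transition i j) u)
      (S i j) u := fun u hu =>
    ((contDiffAt_coordMap hu.1 contMDiffAt_id hu.2).differentiableAt
      (by simp)).hasFDerivAt.hasFDerivWithinAt
  rw [← himg, integral_image_eq_integral_abs_det_fderiv_smul volume (hS i j).measurableSet hder hinj]
  refine setIntegral_congr_fun (hS i j).measurableSet fun u hu => ?_
  exact frameSgn_mul_inChart o η hu.1 hu.2

end Charts

/-! ### The partition of unity and Stokes' theorem on a closed surface -/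

section Compact

variable [IsManifold (𝓡 2) ∞ M] [T2Space M] [CompactSpace M]

theorem chartPartition_subordinate (i : M) :
    tsupport (chartPartition M i) ⊆ (extChartAt (𝓡 2) i).source := by
  rw [extChartAt_source]
  exact (SmoothPartitionOfUnity.exists_isSubordinate_chartAt_source (𝓡 2) M).choose_spec i

variable (M) in
theorem finite_chartPartition_ne_zero : {i : M | (chartPartition M i : M → ℝ) ≠ 0}.Finite := by
  refine ((chartPartition M).locallyFinite.finite_nonempty_of_compact).subset fun i hi => ?_
  exact Function.support_nonempty_iff.2 hi

variable (M) in
/-- The finitely many charts that contribute to the partition of unity. -/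
def activeCharts : Finset M := (finite_chartPartition_ne_zero M).toFinset

theorem chartPartition_eq_zero {i : M} (hi : i ∉ activeCharts M) (x : M) :
    chartPartition M i x = 0 := by
  have : (chartPartition M i : M → ℝ) = 0 := by simpa [activeCharts] using hi
  exact congrFun this x

theorem sum_activeCharts (x : M) : ∑ i ∈ activeCharts M, chartPartition M i x = 1 := by
  rw [← (chartPartition M).sum_eq_one (mem_univ x)]
  refine (finsum_eq_sum_of_support_subset _ fun i hi => ?_).symm
  by_contra h
  exact hi (chartPartition_eq_zero h x)

/-- The image of the support of a function of the partition of unity in its chart. -/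
def chartSupport (i : M) : Set Plane := extChartAt (𝓡 2) i '' tsupport (chartPartition M i)

theorem isCompact_chartSupport (i : M) : IsCompact (chartSupport i) :=
  (isClosed_tsupport _).isCompact.image_of_continuousOn
    ((continuousOn_extChartAt i).mono (chartPartition_subordinate i))

theorem chartSupport_subset (i : M) : chartSupport i ⊆ (extChartAt (𝓡 2) i).target := by
  rintro _ ⟨x, hx, rfl⟩
  exact (extChartAt (𝓡 2) i).map_source (chartPartition_subordinate i hx)

theorem symm_notMem_tsupport {i : M} {u : Plane} (hu : u ∈ (extChartAt (𝓡 2) i).target)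
    (h : u ∉ chartSupport i) : (extChartAt (𝓡 2) i).symm u ∉ tsupport (chartPartition M i) :=
  fun hx => h ⟨_, hx, (extChartAt (𝓡 2) i).right_inv hu⟩

theorem formIntegral_eq_sum (o : SurfaceOrientation M) (η : DForm (𝓡 2) M 2) :
    formIntegral o η =
      ∑ i ∈ activeCharts M, chartIntegral o i (fun x => chartPartition M i x • η x) := by
  have h : formIntegral o η =
      ∑ᶠ i : M, chartIntegral o i (fun x => chartPartition M i x • η x) := by
    unfold formIntegral chartIntegral
    congr 1
    funext i
    congr 1
    funext u
    rw [mul_comm (chartPartition M i _), mul_assoc]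
    rfl
  rw [h]
  refine finsum_eq_sum_of_support_subset _ fun i hi => ?_
  by_contra hn
  refine hi ?_
  refine setIntegral_eq_zero_of_forall_eq_zero fun u _ => ?_
  have : chartPartition M i ((extChartAt (𝓡 2) i).symm u) = 0 := chartPartition_eq_zero hn _
  simp only [DForm.inChart, this, zero_smul]
  exact mul_zero _

/-- A `2`-form is continuous if its expressions in the charts are. -/
def ContinuousForm (η : DForm (𝓡 2) M 2) : Prop :=
  ∀ i : M, ContinuousOn (fun u => η.inChart i u stdFrame) (extChartAt (𝓡 2) i).target

/-- The coefficient may be unbounded near the edge of the chart; integrability comes from the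
compact support inside the target. -/
theorem integrableOn_chart (o : SurfaceOrientation M) {η : DForm (𝓡 2) M 2} {i : M}
    (hη : ContinuousOn (fun u => η.inChart i u stdFrame) (extChartAt (𝓡 2) i).target)
    (h0 : ∀ x ∉ tsupport (chartPartition M i), η x = 0) :
    IntegrableOn (fun u => frameSgn o i u * η.inChart i u stdFrame)
      (extChartAt (𝓡 2) i).target := by
  refine integrableOn_of_continuousOn_of_compact (isOpen_extChartAt_target i)
    (isCompact_chartSupport i) (chartSupport_subset i) ((continuousOn_frameSgn o i).mul hη) ?_
  intro u hu hu'
  simp only [DForm.inChart, h0 _ (symm_notMem_tsupport hu hu')]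
  exact mul_zero _

theorem ContinuousForm.smul {η : DForm (𝓡 2) M 2} (hη : ContinuousForm η) {ρ : M → ℝ}
    (hρ : Continuous ρ) : ContinuousForm (fun x => ρ x • η x) := fun i =>
  (hρ.comp_continuousOn (continuousOn_extChartAt_symm i)).mul (hη i)

theorem integrableOn_chart_smul (o : SurfaceOrientation M) {η : DForm (𝓡 2) M 2}
    (hη : ContinuousForm η) (i : M) :
    IntegrableOn (fun u => frameSgn o i u *
      DForm.inChart (I := 𝓡 2) (fun x => chartPartition M i x • η x) i u stdFrame)
      (extChartAt (𝓡 2) i).target :=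
  integrableOn_chart o (hη.smul (chartPartition M i).contMDiff.continuous i) fun x hx => by
    rw [image_eq_zero_of_notMem_tsupport hx, zero_smul]

theorem formIntegral_add (o : SurfaceOrientation M) {η η' : DForm (𝓡 2) M 2}
    (hη : ContinuousForm η) (hη' : ContinuousForm η') :
    formIntegral o (fun x => η x + η' x) = formIntegral o η + formIntegral o η' := by
  simp only [formIntegral_eq_sum, ← Finset.sum_add_distrib]
  refine Finset.sum_congr rfl fun i _ => ?_
  unfold chartIntegral
  rw [← integral_add (integrableOn_chart_smul o hη i) (integrableOn_chart_smul o hη' i)]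
  congr 1
  funext u
  rw [← mul_add]
  congr 1
  exact mul_add (chartPartition M i _) _ _

theorem formIntegral_const_smul (o : SurfaceOrientation M) (c : ℝ) (η : DForm (𝓡 2) M 2) :
    formIntegral o (fun x => c • η x) = c * formIntegral o η := by
  simp only [formIntegral_eq_sum, Finset.mul_sum]
  refine Finset.sum_congr rfl fun i _ => ?_
  unfold chartIntegral
  rw [← integral_const_mul]
  congr 1
  funext u
  rw [mul_left_comm]
  congr 1
  exact mul_left_comm (chartPartition M i _) c _

theorem DForm.inChart_zero {k : ℕ} (i : M) :
    DForm.inChart (fun _ => 0 : DForm (𝓡 2) M k) i = fun _ => 0 := rfl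

theorem DForm.smoothAt_zero {k : ℕ} (x : M) : DForm.SmoothAt (fun _ => 0 : DForm (𝓡 2) M k) x := by
  unfold DForm.SmoothAt
  rw [DForm.inChart_zero]
  exact contDiffAt_const

theorem DForm.d_zero {k : ℕ} (x : M) : DForm.d (fun _ => 0 : DForm (𝓡 2) M k) x = 0 := by
  have h := DForm.d_add (DForm.smoothAt_zero (k := k) x) (DForm.smoothAt_zero (k := k) x)
  simp only [add_zero] at h
  exact left_eq_add.1 h

theorem DForm.smoothAt_sum {k : ℕ} {ι : Type*} (S : Finset ι) {η : ι → DForm (𝓡 2) M k} {x : M}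
    (h : ∀ i, (η i).SmoothAt x) : DForm.SmoothAt (I := 𝓡 2) (fun y => ∑ i ∈ S, η i y) x := by
  classical
  induction S using Finset.induction_on with
  | empty => simpa only [Finset.sum_empty] using DForm.smoothAt_zero x
  | insert a S ha ih =>
    simp only [Finset.sum_insert ha]
    exact (h a).add ih

theorem DForm.d_sum {k : ℕ} {ι : Type*} (S : Finset ι) {η : ι → DForm (𝓡 2) M k} {x : M}
    (h : ∀ i, (η i).SmoothAt x) :
    DForm.d (I := 𝓡 2) (fun y => ∑ i ∈ S, η i y) x = ∑ i ∈ S, (η i).d x := by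
  classical
  induction S using Finset.induction_on with
  | empty => simpa only [Finset.sum_empty] using DForm.d_zero x
  | insert a S ha ih =>
    simp only [Finset.sum_insert ha]
    rw [DForm.d_add (h a) (DForm.smoothAt_sum S h), ih]

theorem continuousForm_d {α : DForm (𝓡 2) M 1} (hα : ∀ x, α.SmoothAt x) :
    ContinuousForm α.d := fun i u hu => by
  have h := DForm.contDiffAt_inChart_d hu (Eventually.of_forall hα)
  have h1 := ((ContinuousAlternatingMap.apply ℝ Plane ℝ stdFrame).continuous.continuousAt).comp
    h.continuousAt
  exact h1.continuousWithinAt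

/-- Stokes' theorem on a closed oriented surface. -/
theorem formIntegral_d_eq_zero (o : SurfaceOrientation M) {α : DForm (𝓡 2) M 1}
    (hα : ∀ x, α.SmoothAt x) : formIntegral o α.d = 0 := by
  -- The integral cuts d(ρ_j α) by a second factor ρ_i of the same partition. Each ρ_i d(ρ_j α) is
  -- supported in both charts, so it can be moved from chart i to chart j; there the sum over i
  -- restores d(ρ_j α), whose integral vanishes by Stokes in the plane.
  let β : M → DForm (𝓡 2) M 1 := fun j x => chartPartition M j x • α x
  have hβ : ∀ j x, (β j).SmoothAt x := fun j x => (hα x).smul ((chartPartition M j).contMDiff x)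
  have hsum : ∀ x, α.d x = ∑ j ∈ activeCharts M, (β j).d x := by
    intro x
    rw [← DForm.d_sum _ fun j => hβ j x]
    refine DForm.d_congr (Eventually.of_forall fun y => ?_)
    simp only [β]
    rw [← Finset.sum_smul, sum_activeCharts, one_smul]
  have hzero : ∀ j, ∀ x ∉ tsupport (chartPartition M j), β j x = 0 := fun j x hx => by
    simp only [β]
    rw [image_eq_zero_of_notMem_tsupport hx, zero_smul]
  have hdzero : ∀ j, ∀ x ∉ tsupport (chartPartition M j), (β j).d x = 0 := by
    intro j x hx
    rw [← DForm.d_zero x]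
    refine DForm.d_congr ?_
    filter_upwards [(isClosed_tsupport _).isOpen_compl.mem_nhds hx] with y hy using hzero j y hy
  have hstokes : ∀ j, chartIntegral o j (β j).d = 0 := by
    intro j
    have h1 := integral_extDeriv_eq_zero (isOpen_extChartAt_target j) (isCompact_chartSupport j)
      (chartSupport_subset j) (fun u hu => eventually_frameSgn_eq o hu)
      (β := (β j).inChart j) (fun u hu => (hβ j _).contDiffAt_inChart hu)
      (fun u hu hu' => by
        simp only [DForm.inChart, hzero j _ (symm_notMem_tsupport hu hu')]
        rfl)
    refine Eq.trans ?_ h1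
    refine setIntegral_congr_fun (isOpen_extChartAt_target j).measurableSet fun u hu => ?_
    simp only [DForm.inChart_d hu (hβ j _)]
  have hcont : ∀ j, ContinuousForm (β j).d := fun j => continuousForm_d (hβ j)
  have hi : ∀ i j, ∀ x ∉ (extChartAt (𝓡 2) i).source,
      chartPartition M i x • (β j).d x = 0 := fun i j x hx => by
    rw [image_eq_zero_of_notMem_tsupport fun h => hx (chartPartition_subordinate i h), zero_smul]
  have hj : ∀ i j, ∀ x ∉ (extChartAt (𝓡 2) j).source,
      chartPartition M i x • (β j).d x = 0 := fun i j x hx => by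
    rw [hdzero j x fun h => hx (chartPartition_subordinate j h), smul_zero]
  have hdist : ∀ (i : M) (u : Plane), frameSgn o i u *
      DForm.inChart (I := 𝓡 2) (fun x => chartPartition M i x • α.d x) i u stdFrame =
        ∑ j ∈ activeCharts M, frameSgn o i u *
          DForm.inChart (I := 𝓡 2) (fun x => chartPartition M i x • (β j).d x) i u stdFrame := by
    intro i u
    rw [← Finset.mul_sum]
    congr 1
    simp only [DForm.inChart, hsum, Finset.smul_sum]
    change (∑ j ∈ activeCharts M, _ : TangentSpace (𝓡 2) _ [⋀^Fin 2]→L[ℝ] ℝ) _ = _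
    rw [ContinuousAlternatingMap.sum_apply]
    rfl
  have hgather : ∀ (j : M) (u : Plane), ∑ i ∈ activeCharts M, frameSgn o j u *
      DForm.inChart (I := 𝓡 2) (fun x => chartPartition M i x • (β j).d x) j u stdFrame =
        frameSgn o j u * (β j).d.inChart j u stdFrame := by
    intro j u
    rw [← Finset.mul_sum]
    congr 1
    have := sum_activeCharts ((extChartAt (𝓡 2) j).symm u)
    refine Eq.trans ?_ (one_mul ((β j).d.inChart j u stdFrame))
    rw [← this, Finset.sum_mul]
    rfl
  calc formIntegral o α.d
      = ∑ i ∈ activeCharts M, ∑ j ∈ activeCharts M,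
          chartIntegral o i (fun x => chartPartition M i x • (β j).d x) := by
        rw [formIntegral_eq_sum]
        refine Finset.sum_congr rfl fun i _ => ?_
        unfold chartIntegral
        rw [← integral_finsetSum _ fun j _ => integrableOn_chart_smul o (hcont j) i]
        simp only [hdist]
    _ = ∑ j ∈ activeCharts M, ∑ i ∈ activeCharts M,
          chartIntegral o j (fun x => chartPartition M i x • (β j).d x) := by
        rw [Finset.sum_comm]
        exact Finset.sum_congr rfl fun j _ => Finset.sum_congr rfl fun i _ =>
          chartIntegral_eq o (hi i j) (hj i j)
    _ = ∑ j ∈ activeCharts M, chartIntegral o j (β j).d := by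
        refine Finset.sum_congr rfl fun j _ => ?_
        unfold chartIntegral
        rw [← integral_finsetSum]
        · simp only [hgather]
        · intro i _
          refine integrableOn_chart o ((hcont j).smul (chartPartition M i).contMDiff.continuous j) ?_
          intro x hx
          rw [hdzero j x hx, smul_zero]
    _ = 0 := Finset.sum_eq_zero fun j _ => hstokes j

end Compact

end FormIntegral

/-! ### The volume form, the Hodge star and positivity of the volume -/

section Riemannian

set_option linter.unusedSectionVars false

variable {M : Type*} [TopologicalSpace M] [ChartedSpace (EuclideanSpace ℝ (Fin 2)) M]
  [RiemannianBundle (fun x : M => TangentSpace (𝓡 2) x)]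

theorem volForm_apply (o : SurfaceOrientation M) (x : M) (v : Fin 2 → TangentSpace (𝓡 2) x) :
    volForm o x v = (o.orient x).volumeForm v := rfl

theorem volumeForm_eq_det (o : SurfaceOrientation M) (x : M) :
    (o.orient x).volumeForm =
      ((o.orient x).finOrthonormalBasis two_pos Fact.out).toBasis.det :=
  (o.orient x).volumeForm_robust _ ((o.orient x).finOrthonormalBasis_orientation two_pos Fact.out)

theorem volForm_basis (o : SurfaceOrientation M) (x : M) :
    volForm o x ((o.orient x).finOrthonormalBasis two_pos Fact.out) = 1 := by
  rw [volForm_apply, volumeForm_eq_det]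
  have := ((o.orient x).finOrthonormalBasis two_pos Fact.out).toBasis.det_self
  rwa [OrthonormalBasis.coe_toBasis] at this

theorem eq_hodgeStarTwo_smul (o : SurfaceOrientation M) (η : DForm (𝓡 2) M 2) (x : M) :
    η x = hodgeStarTwo o η x • volForm o x := by
  refine ContinuousAlternatingMap.ext fun v => ?_
  have h := (η x).toAlternatingMap.eq_smul_basis_det
    ((o.orient x).finOrthonormalBasis two_pos Fact.out).toBasis
  have h1 := congrArg (fun L : TangentSpace (𝓡 2) x [⋀^Fin 2]→ₗ[ℝ] ℝ => L v) h
  refine h1.trans ?_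
  rw [← volumeForm_eq_det, OrthonormalBasis.coe_toBasis]
  rfl

/-- The volume form represents the orientation ray of each tangent plane, and any representative
gives the same frame signs. -/
theorem frameSgn_eq_sign (o : SurfaceOrientation M) (i : M) (u : Plane) :
    frameSgn o i u = (SignType.sign ((volForm o).inChart i u stdFrame) : ℝ) := by
  unfold frameSgn
  congr 1
  set x := (extChartAt (𝓡 2) i).symm u
  have h0 : (o.orient x).volumeForm ≠ 0 := by
    intro h
    have := volForm_basis o x
    rw [volForm_apply, h] at this
    simp at this
  refine sign_someVector_eq (o.orient x) _ h0 ?_ _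
  have h1 := (o.orient x).finOrthonormalBasis_orientation two_pos Fact.out
  conv_rhs => rw [← h1]
  rw [Module.Basis.orientation]
  congr 1
  exact volumeForm_eq_det o x

theorem frameSgn_mul_volForm (o : SurfaceOrientation M) (i : M) (u : Plane) :
    frameSgn o i u * (volForm o).inChart i u stdFrame = |(volForm o).inChart i u stdFrame| := by
  rw [frameSgn_eq_sign, sign_mul_self]

/-- The Gram determinant of the coordinate frame. -/
def gramDet (i : M) (u : Plane) : ℝ :=
  inner ℝ (coordFrame i u 0) (coordFrame i u 0) * inner ℝ (coordFrame i u 1) (coordFrame i u 1) -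
    inner ℝ (coordFrame i u 0) (coordFrame i u 1) ^ 2

/-- The Lagrange identity ⟨a,b⟩² + ω(a,b)² = |a|²|b|². It expresses the square of the coefficient of
dV through the metric alone. -/
theorem volForm_sq (o : SurfaceOrientation M) (i : M) (u : Plane) :
    (volForm o).inChart i u stdFrame ^ 2 = gramDet i u := by
  have h := (o.orient ((extChartAt (𝓡 2) i).symm u)).inner_sq_add_areaForm_sq
    (coordFrame i u 0) (coordFrame i u 1)
  rw [Orientation.areaForm_to_volumeForm] at h
  have e : (![coordFrame i u 0, coordFrame i u 1] : Fin 2 → _) = coordFrame i u := by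
    funext k; fin_cases k <;> rfl
  rw [e] at h
  unfold gramDet
  rw [real_inner_self_eq_norm_sq, real_inner_self_eq_norm_sq, ← h]
  change (volForm o _ (coordFrame i u)) ^ 2 = _
  rw [volForm_apply]
  ring

variable [IsManifold (𝓡 2) ∞ M]

theorem volForm_inChart_ne_zero (o : SurfaceOrientation M) {i : M} {u : Plane}
    (hu : u ∈ (extChartAt (𝓡 2) i).target) : (volForm o).inChart i u stdFrame ≠ 0 := by
  intro h
  have h1 := alternating_eq_zero (ω' := ((volForm o).inChart i u).toAlternatingMap) h
  set x := (extChartAt (𝓡 2) i).symm u with hx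
  have h2 : ∀ v : Fin 2 → Plane, volForm o x v = 0 := by
    intro v
    have h3 := congrArg (fun L : Plane [⋀^Fin 2]→ₗ[ℝ] ℝ => L fun k =>
      mfderiv (𝓡 2) 𝓘(ℝ, Plane) (extChartAt (𝓡 2) i) x (v k)) h1
    refine Eq.trans ?_ h3
    change volForm o x _ = volForm o x (fun k => _)
    congr 1
    funext k
    have hs : x ∈ (extChartAt (𝓡 2) i).source := (extChartAt (𝓡 2) i).map_target hu
    have h4 := mfderiv_symm_extChartAt hs (v k)
    rw [(extChartAt (𝓡 2) i).right_inv hu] at h4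
    exact h4.symm
  exact one_ne_zero ((volForm_basis o x).symm.trans (h2 _))

variable [IsContMDiffRiemannianBundle (𝓡 2) ∞ (EuclideanSpace ℝ (Fin 2))
    (fun x : M => TangentSpace (𝓡 2) x)]

theorem contMDiffOn_coordFrame (i : M) (k : Fin 2) :
    ContMDiffOn 𝓘(ℝ, Plane) ((𝓡 2).prod 𝓘(ℝ, Plane)) ∞
      (fun u => (⟨(extChartAt (𝓡 2) i).symm u, coordFrame i u k⟩ : TangentBundle (𝓡 2) M))
      (extChartAt (𝓡 2) i).target := by
  have h1 := (contMDiffOn_extChartAt_symm (I := 𝓡 2) (n := ∞) i).contMDiffOn_tangentMapWithin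
    (m := ∞) (by simp) (isOpen_extChartAt_target i).uniqueMDiffOn
  have h2 : ContMDiff 𝓘(ℝ, Plane) (𝓘(ℝ, Plane).prod 𝓘(ℝ, Plane)) ∞
      (fun u : Plane => (⟨u, stdFrame k⟩ : TangentBundle 𝓘(ℝ, Plane) Plane)) := by
    intro u
    rw [contMDiffAt_totalSpace]
    exact ⟨contMDiffAt_id, by simpa using contMDiffAt_const⟩
  refine (h1.comp h2.contMDiffOn fun u hu => hu).congr fun u hu => ?_
  simp only [Function.comp_apply, tangentMapWithin]
  rw [mfderivWithin_of_isOpen (isOpen_extChartAt_target i) hu]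
  rfl

theorem contDiffAt_gramDet {i : M} {u : Plane} (hu : u ∈ (extChartAt (𝓡 2) i).target) :
    ContDiffAt ℝ ∞ (gramDet i) u := by
  have h : ∀ k l : Fin 2, ContDiffAt ℝ ∞
      (fun w => inner ℝ (coordFrame i w k) (coordFrame i w l)) u := by
    intro k l
    have h1 := (contMDiffOn_coordFrame i k).inner_bundle (contMDiffOn_coordFrame i l)
    exact (h1.contMDiffAt ((isOpen_extChartAt_target i).mem_nhds hu)).contDiffAt
  exact ((h 0 0).mul (h 1 1)).sub ((h 0 1).pow 2)

theorem gramDet_pos (o : SurfaceOrientation M) {i : M} {u : Plane}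
    (hu : u ∈ (extChartAt (𝓡 2) i).target) : 0 < gramDet i u := by
  rw [← volForm_sq o]
  exact sq_pos_iff.2 (volForm_inChart_ne_zero o hu)

theorem volForm_inChart_eq (o : SurfaceOrientation M) {i : M} {u : Plane} :
    (volForm o).inChart i u stdFrame = frameSgn o i u * √(gramDet i u) := by
  rw [← volForm_sq o, Real.sqrt_sq_eq_abs, frameSgn_eq_sign, sign_mul_abs]

/-- The orientation enters only through a locally constant sign, so near `u` the coefficient is a
fixed sign times the square root of the smooth positive Gram determinant. -/
theorem contDiffAt_volForm (o : SurfaceOrientation M) {i : M} {u : Plane}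
    (hu : u ∈ (extChartAt (𝓡 2) i).target) :
    ContDiffAt ℝ ∞ (fun w => (volForm o).inChart i w stdFrame) u := by
  have h1 : ContDiffAt ℝ ∞ (fun w => frameSgn o i u * √(gramDet i w)) u :=
    contDiffAt_const.mul ((contDiffAt_gramDet hu).sqrt (gramDet_pos o hu).ne')
  refine h1.congr_of_eventuallyEq ?_
  filter_upwards [eventually_frameSgn_eq o hu] with w hw
  rw [volForm_inChart_eq, hw]

theorem contDiffAt_hodgeStarTwo (o : SurfaceOrientation M) {η : DForm (𝓡 2) M 2} {i : M} {u : Plane}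
    (hu : u ∈ (extChartAt (𝓡 2) i).target) (hη : ContDiffAt ℝ ∞ (η.inChart i) u) :
    ContDiffAt ℝ ∞ (hodgeStarTwo o η ∘ (extChartAt (𝓡 2) i).symm) u := by
  have h0 : ContDiffAt ℝ ∞ (fun w => η.inChart i w stdFrame) u :=
    (ContinuousAlternatingMap.apply ℝ Plane ℝ stdFrame).contDiff.contDiffAt.comp u hη
  refine (h0.div (contDiffAt_volForm o hu)
    (volForm_inChart_ne_zero o hu)).congr_of_eventuallyEq ?_
  filter_upwards [(isOpen_extChartAt_target i).mem_nhds hu] with w hw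
  rw [Pi.div_apply, eq_div_iff (volForm_inChart_ne_zero o hw)]
  have h := eq_hodgeStarTwo_smul o η ((extChartAt (𝓡 2) i).symm w)
  exact (congrArg (fun L : Plane [⋀^Fin 2]→L[ℝ] ℝ => L (coordFrame i w)) h).symm

/-- The two minus signs cancel, so d⋆η = d(⋆η) ∘ J; evaluating at J⁻¹v recovers d(⋆η)(v). -/
theorem mfderiv_hodgeStarTwo_eq_zero (o : SurfaceOrientation M) {η : DForm (𝓡 2) M 2} {x : M}
    (h : codifferential o η x = 0) :
    mfderiv (𝓡 2) 𝓘(ℝ, ℝ) (hodgeStarTwo o η) x = 0 := by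
  refine ContinuousLinearMap.ext fun v => ?_
  have h1 := congrArg (fun L : TangentSpace (𝓡 2) x →L[ℝ] ℝ =>
    L ((o.orient x).rightAngleRotation.symm v)) h
  simp only [codifferential, hodgeStarOne, neg_neg] at h1
  have h2 : (o.orient x).rightAngleRotation ((o.orient x).rightAngleRotation.symm v) = v :=
    LinearIsometryEquiv.apply_symm_apply _ _
  refine Eq.trans ?_ h1
  change _ = mfderiv (𝓡 2) 𝓘(ℝ, ℝ) (hodgeStarTwo o η) x
    ((o.orient x).rightAngleRotation ((o.orient x).rightAngleRotation.symm v))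
  rw [h2]

theorem hodgeStarTwo_const [PreconnectedSpace M] (o : SurfaceOrientation M) {η : DForm (𝓡 2) M 2}
    (hη : ∀ (i : M), ∀ u ∈ (extChartAt (𝓡 2) i).target, ContDiffAt ℝ ∞ (η.inChart i) u)
    (h : ∀ x, codifferential o η x = 0) (x y : M) :
    hodgeStarTwo o η x = hodgeStarTwo o η y := by
  refine IsLocallyConstant.apply_eq_of_preconnectedSpace ?_ x y
  rw [IsLocallyConstant.iff_eventually_eq]
  intro i
  set f := hodgeStarTwo o η
  -- The target of the chart need not be connected, so the argument is made on a ball inside it.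
  obtain ⟨r, hr, hball⟩ := Metric.isOpen_iff.1 (isOpen_extChartAt_target (I := 𝓡 2) i) _
    (mem_extChartAt_target i)
  have hdiff : ∀ u ∈ (extChartAt (𝓡 2) i).target,
      DifferentiableAt ℝ (f ∘ (extChartAt (𝓡 2) i).symm) u := fun u hu =>
    (contDiffAt_hodgeStarTwo o hu (hη i u hu)).differentiableAt (by simp)
  have hmd : ∀ x ∈ (extChartAt (𝓡 2) i).source, MDifferentiableAt (𝓡 2) 𝓘(ℝ, ℝ) f x := by
    intro x hx
    have h1 := (hdiff _ ((extChartAt (𝓡 2) i).map_source hx)).mdifferentiableAt.comp x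
      (mdifferentiableAt_extChartAt' hx)
    refine h1.congr_of_eventuallyEq ?_
    filter_upwards [(isOpen_extChartAt_source i).mem_nhds hx] with y hy
    simp only [Function.comp_apply, (extChartAt (𝓡 2) i).left_inv hy]
  have hfd : ∀ u ∈ (extChartAt (𝓡 2) i).target,
      fderiv ℝ (f ∘ (extChartAt (𝓡 2) i).symm) u = 0 := by
    intro u hu
    rw [← mfderiv_eq_fderiv, mfderiv_comp u (hmd _ ((extChartAt (𝓡 2) i).map_target hu))
      (mdifferentiableAt_extChartAt_symm hu), mfderiv_hodgeStarTwo_eq_zero o (h _)]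
    rfl
  have hev : extChartAt (𝓡 2) i ⁻¹' Metric.ball (extChartAt (𝓡 2) i i) r ∈ 𝓝 i :=
    (continuousAt_extChartAt i).preimage_mem_nhds (Metric.ball_mem_nhds _ hr)
  filter_upwards [hev, extChartAt_source_mem_nhds (I := 𝓡 2) i] with y hy hys
  have := Metric.isOpen_ball.is_const_of_fderiv_eq_zero (convex_ball _ r).isPreconnected
    (fun u hu => (hdiff u (hball hu)).differentiableWithinAt) (fun u hu => hfd u (hball hu))
    hy (Metric.mem_ball_self hr)
  simpa only [Function.comp_apply, (extChartAt (𝓡 2) i).left_inv hys, extChartAt_to_inv] using this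

theorem continuousForm_volForm (o : SurfaceOrientation M) [T2Space M] [CompactSpace M] :
    ContinuousForm (volForm o) := fun _ _ hu =>
  (contDiffAt_volForm o hu).continuousAt.continuousWithinAt

/-- The frame sign turns the coefficient of dV into its absolute value, so no summand is negative,
and a chart with ρ_i(x) > 0 has a positive integrand on a nonempty open set. -/
theorem surfaceVolume_pos (o : SurfaceOrientation M) [T2Space M] [CompactSpace M] [Nonempty M] :
    0 < surfaceVolume o := by
  obtain ⟨x⟩ := ‹Nonempty M›
  obtain ⟨i, hi⟩ := (chartPartition M).exists_pos_of_mem (mem_univ x)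
  unfold surfaceVolume
  rw [formIntegral_eq_sum]
  have hval : ∀ (j : M) (u : Plane), frameSgn o j u *
      DForm.inChart (I := 𝓡 2) (fun x => chartPartition M j x • volForm o x) j u stdFrame =
      chartPartition M j ((extChartAt (𝓡 2) j).symm u) * |(volForm o).inChart j u stdFrame| := by
    intro j u
    rw [← frameSgn_mul_volForm, mul_left_comm]
    rfl
  have hnn : ∀ (j : M) (u : Plane), 0 ≤ frameSgn o j u *
      DForm.inChart (I := 𝓡 2) (fun x => chartPartition M j x • volForm o x) j u stdFrame := by
    intro j u
    rw [hval]
    exact mul_nonneg ((chartPartition M).nonneg _ _) (abs_nonneg _)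
  have hmem : i ∈ activeCharts M := by
    by_contra h
    rw [chartPartition_eq_zero h] at hi
    exact lt_irrefl _ hi
  refine Finset.sum_pos' (fun j _ => setIntegral_nonneg
    (isOpen_extChartAt_target j).measurableSet fun u _ => hnn j u) ⟨i, hmem, ?_⟩
  unfold chartIntegral
  rw [setIntegral_pos_iff_support_of_nonneg_ae (Eventually.of_forall fun u => hnn i u)
    (integrableOn_chart_smul o (continuousForm_volForm o) i)]
  have hxs : x ∈ (extChartAt (𝓡 2) i).source :=
    chartPartition_subordinate i (subset_tsupport _ hi.ne')
  have hsub : (extChartAt (𝓡 2) i).target ∩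
      (extChartAt (𝓡 2) i).symm ⁻¹' {y | 0 < chartPartition M i y} ⊆
      Function.support (fun u => frameSgn o i u *
        DForm.inChart (I := 𝓡 2) (fun x => chartPartition M i x • volForm o x) i u stdFrame) ∩
        (extChartAt (𝓡 2) i).target := by
    rintro u ⟨hu, hu'⟩
    refine ⟨?_, hu⟩
    rw [Function.mem_support, hval]
    exact (mul_pos hu' (abs_pos.2 (volForm_inChart_ne_zero o hu))).ne'
  refine lt_of_lt_of_le ?_ (measure_mono hsub)
  refine IsOpen.measure_pos _ ?_ ⟨extChartAt (𝓡 2) i x, (extChartAt (𝓡 2) i).map_source hxs, ?_⟩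
  · exact (continuousOn_extChartAt_symm i).isOpen_inter_preimage (isOpen_extChartAt_target i)
      (isOpen_lt continuous_const (chartPartition M i).contMDiff.continuous)
  · simpa only [mem_preimage, mem_ofPred_eq, (extChartAt (𝓡 2) i).left_inv hxs] using hi

end Riemannian

end YMSurface

end

/-! ### The theorem -/

open YMSurface in
theorem mainTheorem6
    {M : Type*} [TopologicalSpace M] [T2Space M] [CompactSpace M] [ConnectedSpace M]
    [ChartedSpace (EuclideanSpace ℝ (Fin 2)) M] [IsManifold (𝓡 2) ∞ M]
    [RiemannianBundle (fun x : M => TangentSpace (𝓡 2) x)]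
    [IsContMDiffRiemannianBundle (𝓡 2) ∞ (EuclideanSpace ℝ (Fin 2))
      (fun x : M => TangentSpace (𝓡 2) x)]
    (o : SurfaceOrientation M)
    {EP : Type*} [NormedAddCommGroup EP] [NormedSpace ℝ EP]
    {HP : Type*} [TopologicalSpace HP] {IP : ModelWithCorners ℝ EP HP} [IP.Boundaryless]
    {P : Type*} [TopologicalSpace P] [ChartedSpace HP P] [IsManifold IP ∞ P] [MulAction Circle P]
    (pr : P → M) (hpr : IsPrincipalCircleBundle IP pr)
    (A : CircleConnection IP P) (hA : A.IsYangMills pr o) :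
    A.IsCurvature pr (A.curvature pr) ∧
    (∀ A' : CircleConnection IP P, A'.chernNumber pr o = A.chernNumber pr o) ∧
    ∀ x : M, A.curvature pr x =
      (2 * Real.pi * A.chernNumber pr o / surfaceVolume o) • volForm o x := by
  refine ⟨hpr.isCurvature_curvature A, fun A' => ?_, fun x => ?_⟩
  · obtain ⟨α, hα, hF⟩ := hpr.exists_curvature_eq_add A A'
    have hc : ContinuousForm (A.curvature pr) := fun i u hu =>
      (((ContinuousAlternatingMap.apply ℝ Plane ℝ stdFrame).continuous.continuousAt).comp
        (hpr.contDiffAt_curvature A hu).continuousAt).continuousWithinAt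
    unfold CircleConnection.chernNumber
    rw [show A'.curvature pr = fun x => A.curvature pr x + α.d x from funext hF,
      formIntegral_add o hc (continuousForm_d hα), formIntegral_d_eq_zero o hα, add_zero]
  -- The constant λ is the value of ⋆F_A at the given point `x`.
  · have h1 : ∀ y, A.curvature pr y = hodgeStarTwo o (A.curvature pr) x • volForm o y := by
      intro y
      rw [hodgeStarTwo_const o (fun i u hu => hpr.contDiffAt_curvature A hu) hA x y]
      exact eq_hodgeStarTwo_smul o _ y
    have h2 : formIntegral o (A.curvature pr) =
        hodgeStarTwo o (A.curvature pr) x * surfaceVolume o := by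
      -- Only the left side is rewritten, since the constant on the right also contains the
      -- curvature.
      conv_lhs => rw [show A.curvature pr = fun y =>
        hodgeStarTwo o (A.curvature pr) x • volForm o y from funext h1]
      exact formIntegral_const_smul o _ _
    have h3 : 2 * Real.pi * A.chernNumber pr o / surfaceVolume o =
        hodgeStarTwo o (A.curvature pr) x := by
      unfold CircleConnection.chernNumber
      rw [h2]
      have := (surfaceVolume_pos o).ne'
      have := Real.pi_ne_zero
      field_simp
    rw [h3]
    exact h1 x
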